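/- Fix $\alpha\in(0,1)$. For an open set $O$ and $k\in\mathbb N$, $\mathrm{BUC}^{k+\alpha}(O)$ is the space of $C^k$ functions whose derivatives of order $\le k$ are bounded and whose derivatives of order $k$ are uniformly $\alpha$-Hölder continuous on $O$; such functions are identified with their continuous extensions to $\overline O$. **Waves.** Let $g,\sigma\ge 0$ with $g+\sigma>0$. A *symmetric steady wave without stagnation points* consists of a profile $\eta\in \mathrm{BUC}^{2+\alpha}(\mathbb R)$, a fluid domain $\Omega_\eta=\{y<\eta(x)\}$ (infinite depth) or $\Omega_\eta=\{b<y<\eta(x)\}$ with $b<\eta$ on $\mathbb R$ (finite depth, with impermeable bed: $v=0$ on $y=b$), a velocity field with $u,v\in \mathrm{BUC}^{1+\alpha}(\Omega_\eta)$, and a pressure $P\in C(\overline{\Omega_\eta})\cap C^1(\Omega_\eta)$ with $\nabla P\in\mathrm{BUC}^{\alpha}(\Omega_\eta)$, such that $$uu_x+vu_y=-P_x,\qquad uv_x+vv_y=-P_y-g,\qquad u_x+v_y=0\qquad\text{in }\Omega_\eta,$$ $$P=-\sigma\,\frac{\eta''}{(1+\eta'^2)^{3/2}},\qquad v=u\eta'\qquad\text{on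 } y=\eta(x),$$ $\sup_{\Omega_\eta}u<0$, the vorticity $\omega=u_y-v_x$ belongs to $\mathrm{BUC}^{k+\alpha}(\Omega_\eta)$ for every $k\in\mathbb N$, and $\eta,u,P$ are even and $v$ is odd in $x$. No periodicity and no behaviour at infinity is prescribed, so periodic and solitary waves are both included. Put $\psi(x,y)=-\int_y^{\eta(x)}u(x,s)\,ds$ and $\mathcal H(x,y)=(x,-\psi(x,y))$ on $\overline{\Omega_\eta}$; $\mathcal H$ is injective there. Let $h(q,p)$ be the second component of $\mathcal H^{-1}(q,p)$ (the height function), and let $\gamma=\omega\circ\mathcal H^{-1}$ be the vorticity function, which depends on $p$ only. **Theorem.** Let $(0,\overline y)\in\overline{\Omega_\eta}$ with $\overline y<\eta(0)$, put $\overline p=-\psi(0,\overline y)<0$, and assume that there are constants $C,L>0$ with $$\|\partial_q^m h\|_{\mathrm{BUC}^{2+\alpha}(\mathbb R\times(\overline p,0))}\le C\,L^m\,m!\qquad\text{for all } m\ge 0.$$ Then, for a given vorticity function $\gamma$ on $(\overline p,0)$, the free surface, the surface layer $\{(x,y)\in\overline{\Omega_\eta}: 0\le\psi(x,y)\le-\overline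 p\}$ and the velocity field $(u,v)$ in this layer are determined by the function $[\overline y,\eta(0)]\ni y\mapsto u(0,y)$. That is: let two such waves be given (possibly with different $g$, $\sigma$, $C$, $L$, and with different, finite or infinite, depths), both satisfying the above assumptions with the same $\overline y$. If $\eta_1(0)=\eta_2(0)$, $u_1(0,y)=u_2(0,y)$ for all $y\in[\overline y,\eta_1(0)]$ (so that $\overline p_1=\overline p_2=:\overline p$), and $\gamma_1=\gamma_2$ on $(\overline p,0)$, then $\eta_1=\eta_2$ on $\mathbb R$, the two surface layers coincide, and $(u_1,v_1)=(u_2,v_2)$ in the layer. -/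

import Mathlib

namespace WaterWave

noncomputable section

/-! ### Partial derivatives and Hölder spaces -/

/-- Partial derivative with respect to the first (horizontal) variable. -/
def d1 (f : ℝ × ℝ → ℝ) (z : ℝ × ℝ) : ℝ := fderiv ℝ f z (1, 0)

/-- Partial derivative with respect to the second (vertical) variable. -/
def d2 (f : ℝ × ℝ → ℝ) (z : ℝ × ℝ) : ℝ := fderiv ℝ f z (0, 1)

/-- For an open set `O`: `f` belongs to `BUC^{k+α}(O)` with norm at most `M`, the norm being the
maximum of the suprema over `O` of the derivatives of order `≤ k` and of the `α`-Hölder seminorm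
of the derivative of order `k`. -/
structure BUCNormLE {E : Type*} [NormedAddCommGroup E] [NormedSpace ℝ E]
    (k : ℕ) (α : ℝ) (O : Set E) (f : E → ℝ) (M : ℝ) : Prop where
  contDiffOn : ContDiffOn ℝ (k : WithTop ℕ∞) f O
  bound : ∀ j ≤ k, ∀ x ∈ O, ‖iteratedFDeriv ℝ j f x‖ ≤ M
  holder : ∀ x ∈ O, ∀ y ∈ O,
    ‖iteratedFDeriv ℝ k f x - iteratedFDeriv ℝ k f y‖ ≤ M * ‖x - y‖ ^ α

/-- `f ∈ BUC^{k+α}(O)` for an open set `O`. -/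
def MemBUC {E : Type*} [NormedAddCommGroup E] [NormedSpace ℝ E]
    (k : ℕ) (α : ℝ) (O : Set E) (f : E → ℝ) : Prop :=
  ∃ M : ℝ, BUCNormLE k α O f M

/-! ### Steady waves -/

/-- The unknowns of the problem, without any law: the surface profile `η`, the velocity `(u, v)`
and the pressure `P` in the frame moving with the wave, and the level of the flat bed, which is
`⊥` for infinite depth. The values of `u`, `v`, `P` outside the closed fluid domain are
irrelevant. -/
structure Flow where
  η : ℝ → ℝ
  u : ℝ × ℝ → ℝ
  v : ℝ × ℝ → ℝ
  P : ℝ × ℝ → ℝ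
  bed : WithBot ℝ

namespace Flow

/-- The fluid domain `Ω_η`. -/
def domain (W : Flow) : Set (ℝ × ℝ) :=
  {z | W.bed < (z.2 : WithBot ℝ) ∧ z.2 < W.η z.1}

/-- The closure of the fluid domain (for continuous `η` lying above the bed). -/
def closedDomain (W : Flow) : Set (ℝ × ℝ) :=
  {z | W.bed ≤ (z.2 : WithBot ℝ) ∧ z.2 ≤ W.η z.1}

/-- The vorticity `ω = u_y - v_x`. -/
def vorticity (W : Flow) (z : ℝ × ℝ) : ℝ := d2 W.u z - d1 W.v z

/-- The stream function `ψ(x,y) = -∫_y^{η(x)} u(x,s) ds`. -/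
def stream (W : Flow) (z : ℝ × ℝ) : ℝ := -∫ s in z.2..W.η z.1, W.u (z.1, s)

/-- The semihodograph transform `ℋ(x,y) = (x, -ψ(x,y))`. -/
def hodograph (W : Flow) (z : ℝ × ℝ) : ℝ × ℝ := (z.1, -W.stream z)

/-- The inverse of the semihodograph transform on the closed fluid domain. -/
def hodographInv (W : Flow) : ℝ × ℝ → ℝ × ℝ :=
  Function.invFunOn W.hodograph W.closedDomain

/-- The height function `h = y ∘ ℋ⁻¹`. -/
def height (W : Flow) (z : ℝ × ℝ) : ℝ := (W.hodographInv z).2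

/-- The vorticity function `γ = ω ∘ ℋ⁻¹`, which depends on `p` only for steady flows; it is
read off here on the line `q = 0`. -/
def vorticityFn (W : Flow) (p : ℝ) : ℝ := W.vorticity (W.hodographInv (0, p))

/-- The surface layer `{(x,y) ∈ closure Ω_η : 0 ≤ ψ(x,y) ≤ -p}`. -/
def layer (W : Flow) (p : ℝ) : Set (ℝ × ℝ) :=
  {z | z ∈ W.closedDomain ∧ 0 ≤ W.stream z ∧ W.stream z ≤ -p}

/-- `W` is a symmetric steady wave without stagnation points and with smooth vorticity, for the
gravity constant `g` and the surface tension coefficient `σ`. No periodicity and no behaviour at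
infinity is prescribed. -/
structure IsSymmetricWave (W : Flow) (g σ α : ℝ) : Prop where
  /-- the surface lies above the bed -/
  bed_lt : ∀ x : ℝ, W.bed < (W.η x : WithBot ℝ)
  /-- in finite depth the bed is impermeable -/
  impermeable : ∀ b : ℝ, W.bed = (b : WithBot ℝ) → ∀ x : ℝ, W.v (x, b) = 0
  -- regularity; the functions on the closed domain are the continuous extensions
  η_mem : MemBUC 2 α Set.univ W.η
  u_cont : ContinuousOn W.u W.closedDomain
  u_mem : MemBUC 1 α W.domain W.u
  v_cont : ContinuousOn W.v W.closedDomain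
  v_mem : MemBUC 1 α W.domain W.v
  /-- `P` is `C¹` with `∇P ∈ BUC^α`; `P` itself may be unbounded (hydrostatic pressure) in
  infinite depth -/
  P_cont : ContinuousOn W.P W.closedDomain
  P_contDiffOn : ContDiffOn ℝ 1 W.P W.domain
  P_d1_mem : MemBUC 0 α W.domain (d1 W.P)
  P_d2_mem : MemBUC 0 α W.domain (d2 W.P)
  vorticity_mem : ∀ k : ℕ, MemBUC k α W.domain W.vorticity
  -- Euler equations
  euler_x : ∀ z ∈ W.domain, W.u z * d1 W.u z + W.v z * d2 W.u z = -d1 W.P z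
  euler_y : ∀ z ∈ W.domain, W.u z * d1 W.v z + W.v z * d2 W.v z = -d2 W.P z - g
  incompressible : ∀ z ∈ W.domain, d1 W.u z + d2 W.v z = 0
  -- dynamic and kinematic conditions on the free surface
  dynamic : ∀ x : ℝ, W.P (x, W.η x) =
    -σ * (deriv (deriv W.η) x / (1 + deriv W.η x ^ 2) ^ (3 / 2 : ℝ))
  kinematic : ∀ x : ℝ, W.v (x, W.η x) = W.u (x, W.η x) * deriv W.η x
  /-- no stagnation points: `sup u < 0` -/
  no_stagnation : ∃ δ : ℝ, 0 < δ ∧ ∀ z ∈ W.domain, W.u z ≤ -δ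
  -- symmetry with respect to the line `x = 0`
  η_even : ∀ x : ℝ, W.η (-x) = W.η x
  u_even : ∀ x y : ℝ, (x, y) ∈ W.domain → W.u (-x, y) = W.u (x, y)
  v_odd : ∀ x y : ℝ, (x, y) ∈ W.domain → W.v (-x, y) = -W.v (x, y)
  P_even : ∀ x y : ℝ, (x, y) ∈ W.domain → W.P (-x, y) = W.P (x, y)

/-- The estimates `‖∂_q^m h‖_{BUC^{2+α}(ℝ × (p,0))} ≤ C L^m m!` for all `m ≥ 0`, with some
constants `C, L > 0`. -/
def HeightAnalytic (W : Flow) (α p : ℝ) : Prop :=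
  ∃ C L : ℝ, 0 < C ∧ 0 < L ∧ ∀ m : ℕ,
    BUCNormLE 2 α {z : ℝ × ℝ | p < z.2 ∧ z.2 < 0} (d1^[m] W.height)
      (C * L ^ m * (m.factorial : ℝ))

end Flow

end

end WaterWave

/-! ### Taylor expansion and unique continuation for functions of one variable. -/

namespace WaterWave

open Set Filter Topology Asymptotics

/-! The theorem is a Cauchy uniqueness statement for the height equation (1 + h_q²) h_pp - 2 h_q h_p
h_pq + h_p² h_qq = γ(p) h_p³ in the strip p̄ < p < 0, with data on q = 0. The values u(0,·) give
ψ(0,·), hence h(0,·), and symmetry gives h_q(0,·) = 0. Since h_p ≠ 0, the line q = 0 is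
noncharacteristic: solving for h_qq determines all ∂_q^m h(0,p) recursively
(`AnalyticHeight.iterate_d1_eq`). The factorial bounds make h(·,p) real analytic on the whole line,
so these derivatives determine it (`DerivChain.eq_zero_of_bound`).

The recursion avoids differentiating the nonlinear equation n times. If two solutions have the same
q-derivatives up to order n + 1 on q = 0 for every p, these equalities may be differentiated in p;
the right-hand sides for h_qq then differ by O(q^(n+1)), so the next q-derivative agrees too.

The equation comes from u h_p = -1 (`u_mul_d2_height`), the streamline relation v = u h_q (`v_eq`),
and constancy of ω along streamlines (`vorticity_height`). Conversely h gives everything back: η is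
its limit as p → 0, the layer is the closure of its values on each vertical line, u = -1/h_p and v =
u h_q. -/

/-- A sequence of functions each of which is the derivative of its predecessor. -/
def DerivChain (F : ℕ → ℝ → ℝ) : Prop := ∀ j q, HasDerivAt (F j) (F (j + 1) q) q

namespace DerivChain

variable {F G : ℕ → ℝ → ℝ}

lemma shift (hF : DerivChain F) (k : ℕ) : DerivChain fun j => F (j + k) := fun j q => by
  have := hF (j + k) q
  rwa [add_right_comm] at this

lemma sub (hF : DerivChain F) (hG : DerivChain G) : DerivChain fun j q => F j q - G j q :=
  fun j q => (hF j q).sub (hG j q)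

lemma reflect (hF : DerivChain F) (c : ℝ) : DerivChain fun j q => (-1) ^ j * F j (c - q) :=
  fun j q => by
    have h := ((hF j (c - q)).comp q ((hasDerivAt_id q).const_sub c)).const_mul ((-1 : ℝ) ^ j)
    refine HasDerivAt.congr_deriv (f := fun q => (-1 : ℝ) ^ j * F j (c - q)) h ?_
    beta_reduce
    rw [pow_succ]
    ring

lemma continuous (hF : DerivChain F) (j : ℕ) : Continuous (F j) :=
  continuous_iff_continuousAt.2 fun q => (hF j q).continuousAt

/-- Induction on the order: the bound for `F 1` is integrated once by the mean value inequality with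
a majorant. -/
lemma abs_le_right {M a b : ℝ} : ∀ (n : ℕ) {F : ℕ → ℝ → ℝ}, DerivChain F → (∀ j < n, F j a = 0) →
    (∀ x ∈ Icc a b, |F n x| ≤ M) → ∀ x ∈ Icc a b, |F 0 x| ≤ M * (x - a) ^ n / n.factorial
  | 0, F, _, _, hM => fun x hx => by simpa using hM x hx
  | n + 1, F, hF, h0, hM => fun x hx => by
    have ih := abs_le_right n (hF.shift 1) (fun j hj => h0 (j + 1) (by omega)) hM
    have key := image_norm_le_of_norm_deriv_right_le_deriv_boundary (f := F 0) (f' := F 1)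
      (a := a) (b := b) (B := fun x => M * (x - a) ^ (n + 1) / (n + 1).factorial)
      (B' := fun x => M * (x - a) ^ n / n.factorial)
      (hF.continuous 0).continuousOn (fun y _ => (hF 0 y).hasDerivWithinAt)
      (by simp [h0 0 (by omega)])
      (fun y => by
        have h := (((((hasDerivAt_id y).sub_const a).pow (n + 1)).const_mul M).div_const
          ((n + 1).factorial : ℝ))
        refine HasDerivAt.congr_deriv
          (f := fun x => M * (x - a) ^ (n + 1) / (n + 1).factorial) h ?_
        rw [Nat.factorial_succ]
        push_cast
        simp only [id]
        have : (n.factorial : ℝ) ≠ 0 := by positivity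
        have : (n + 1 : ℝ) ≠ 0 := by positivity
        field_simp)
      (fun y hy => ih y ⟨hy.1, hy.2.le⟩)
    exact key hx

lemma abs_le {M a r : ℝ} (n : ℕ) (hF : DerivChain F) (h0 : ∀ j < n, F j a = 0)
    (hM : ∀ x, |x - a| ≤ r → |F n x| ≤ M) (x : ℝ) (hx : |x - a| ≤ r) :
    |F 0 x| ≤ M * |x - a| ^ n / n.factorial := by
  rcases le_total a x with h | h
  · rw [abs_of_nonneg (sub_nonneg.2 h)] at hx ⊢
    exact abs_le_right (b := a + r) n hF h0
      (fun y hy => hM y (by rw [abs_of_nonneg (sub_nonneg.2 hy.1)]; linarith [hy.2])) x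
      ⟨h, by linarith⟩
  · rw [abs_of_nonpos (sub_nonpos.2 h)] at hx ⊢
    -- Reflection about `a` reduces points to the left of `a` to the one-sided bound.
    have := abs_le_right (a := a) (b := a + r) (M := M) n (hF.reflect (2 * a))
      (fun j hj => by
        have : 2 * a - a = a := by ring
        simp [this, h0 j hj])
      (fun y hy => by
        rw [abs_mul, abs_pow, abs_neg, abs_one, one_pow, one_mul]
        exact hM _ (by rw [abs_of_nonpos (by linarith [hy.1])]; linarith [hy.2]))
      (2 * a - x) ⟨by linarith, by linarith⟩
    simp only [pow_zero, one_mul, sub_sub_cancel] at this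
    convert this using 3
    ring

lemma isBigO (hF : DerivChain F) {n : ℕ} (h0 : ∀ j < n, F j 0 = 0) :
    F 0 =O[𝓝 0] fun q : ℝ => q ^ n := by
  obtain ⟨M, hM⟩ := (isCompact_Icc (a := (-1 : ℝ)) (b := 1)).exists_bound_of_continuousOn
    (hF.continuous n).continuousOn
  refine IsBigO.of_bound (M / n.factorial) ?_
  filter_upwards [Metric.closedBall_mem_nhds (0 : ℝ) one_pos] with q hq
  rw [Metric.mem_closedBall, Real.dist_eq] at hq
  have := hF.abs_le (a := 0) (r := 1) n h0 (fun x hx => hM x (by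
    rw [sub_zero] at hx; exact abs_le'.1 hx |>.elim fun a b => ⟨by linarith, a⟩)) q hq
  rw [sub_zero] at this
  rw [Real.norm_eq_abs, Real.norm_eq_abs, abs_pow]
  calc |F 0 q| ≤ _ := this
    _ = _ := by ring

/-- For `j > k` the factor `k.descFactorial j` vanishes, so the truncated exponent `k - j` does no
harm. -/
lemma monomial (c : ℝ) (k : ℕ) :
    DerivChain fun j q => c * (k.descFactorial j * q ^ (k - j)) := fun j q => by
  have h := ((hasDerivAt_pow (k - j) q).const_mul (k.descFactorial j : ℝ)).const_mul c
  refine h.congr_deriv ?_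
  beta_reduce
  rw [Nat.descFactorial_succ, Nat.sub_sub]
  push_cast
  ring

/-- Taylor coefficients are removed one at a time: once those below `k` vanish, `F 0` is `c * q ^ k`
up to O(q^(k+1)), while `F 0` itself is O(q^(k+1)); hence `c * q ^ k` = o(q^k) and `c = 0`. -/
lemma eq_zero_of_isBigO (hF : DerivChain F) {n : ℕ} (h : F 0 =O[𝓝 0] fun q : ℝ => q ^ n) :
    ∀ j < n, F j 0 = 0 := by
  intro k
  induction k using Nat.strong_induction_on with
  | _ k ih =>
    intro hk
    set c : ℝ := F k 0 / k.factorial with hc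
    have hfac : (k.factorial : ℝ) ≠ 0 := by positivity
    have h1 := (hF.sub (monomial c k)).isBigO (n := k + 1) (fun j hj => by
      rcases Nat.lt_succ_iff_lt_or_eq.1 hj with hj | rfl
      · have : k - j ≠ 0 := by omega
        simp [ih j hj (hj.trans hk), this]
      · simp [Nat.descFactorial_self, hc, hfac])
    have hpow : (fun q : ℝ => q ^ n) =O[𝓝 0] fun q : ℝ => q ^ (k + 1) :=
      (show k + 1 ≤ n from hk).eq_or_lt.elim (fun h => h ▸ isBigO_refl _ _)
        fun h => (isLittleO_pow_pow h).isBigO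
    have h2 := (h.trans hpow).sub h1
    simp only [sub_sub_cancel, Nat.descFactorial_zero, Nat.cast_one, one_mul, Nat.sub_zero] at h2
    have h3 : (fun q : ℝ => c * q ^ k) =o[𝓝 0] fun q : ℝ => q ^ k :=
      h2.trans_isLittleO (isLittleO_pow_pow (Nat.lt_succ_self k))
    by_contra hne
    have hc0 : c ≠ 0 := div_ne_zero hne hfac
    have h4 : (fun q : ℝ => q ^ k) =o[𝓝 0] fun q : ℝ => q ^ k :=
      (isLittleO_const_mul_left_iff hc0).1 h3
    refine isLittleO_irrefl (l := 𝓝[≠] (0 : ℝ)) (Eventually.frequently ?_)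
      (h4.mono nhdsWithin_le_nhds)
    filter_upwards [self_mem_nhdsWithin] with q hq using pow_ne_zero _ hq

/-- A smooth function on the line with factorial bounds on its derivatives vanishes identically
if all its derivatives vanish at one point. -/
theorem eq_zero_of_bound (hF : DerivChain F) {C L a : ℝ} (hL : 0 < L)
    (hb : ∀ m q, |F m q| ≤ C * L ^ m * m.factorial) (h0 : ∀ m, F m a = 0) (q : ℝ) :
    F 0 q = 0 := by
  -- The common zero set of all derivatives is closed, nonempty and open, hence the whole line.
  set Z : Set ℝ := ⋂ m, {q | F m q = 0} with hZ
  have hclosed : IsClosed Z :=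
    isClosed_iInter fun m => isClosed_eq (hF.continuous m) continuous_const
  have hopen : IsOpen Z := by
    -- Within distance 1/(2L) of `b` the Taylor bound C (L |y - b|)^n is at most C 2^(-n), for every
    -- n.
    refine Metric.isOpen_iff.2 fun b hbZ => ⟨1 / (2 * L), by positivity, fun x hx => ?_⟩
    rw [mem_iInter] at hbZ ⊢
    have hzero : ∀ y ∈ Metric.ball b (1 / (2 * L)), F 0 y = 0 := fun y hy => by
      rw [Metric.mem_ball, Real.dist_eq] at hy
      have hLy : L * |y - b| ≤ 1 / 2 := by
        have := mul_le_mul_of_nonneg_left hy.le hL.le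
        field_simp at this ⊢
        linarith
      have hn : ∀ n : ℕ, |F 0 y| ≤ C * (1 / 2) ^ n := fun n => by
        have h1 := hF.abs_le (a := b) (r := |y - b|) n (fun j _ => hbZ j)
          (fun x _ => hb n x) y le_rfl
        have hC : 0 ≤ C := by
          have := (abs_nonneg _).trans (hb 0 0)
          simpa using this
        have hfac : (n.factorial : ℝ) ≠ 0 := by positivity
        calc |F 0 y| ≤ _ := h1
          _ = C * (L * |y - b|) ^ n := by
            rw [mul_pow]
            field_simp
          _ ≤ _ := by gcongr
      have hlim : Tendsto (fun n : ℕ => C * (1 / 2 : ℝ) ^ n) atTop (𝓝 (C * 0)) :=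
        (tendsto_pow_atTop_nhds_zero_of_lt_one (by norm_num) (by norm_num)).const_mul C
      have := ge_of_tendsto' hlim hn
      rw [mul_zero] at this
      exact abs_nonpos_iff.1 this
    intro m
    have hall : ∀ m, ∀ y ∈ Metric.ball b (1 / (2 * L)), F m y = 0 := fun m => by
      induction m with
      | zero => exact hzero
      | succ m ih =>
        intro y hy
        have he : F m =ᶠ[𝓝 y] fun _ => 0 := by
          filter_upwards [Metric.isOpen_ball.mem_nhds hy] with t ht using ih t ht
        exact (hF m y).unique ((hasDerivAt_const y (0 : ℝ)).congr_of_eventuallyEq he)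
    exact hall m x hx
  have huniv := IsClopen.eq_univ ⟨hclosed, hopen⟩ ⟨a, mem_iInter.2 h0⟩
  have : q ∈ Z := huniv ▸ mem_univ q
  exact mem_iInter.1 this 0

end DerivChain

end WaterWave

namespace WaterWave

open Set Filter Topology Asymptotics

/-! ### Calculus of the partial derivatives -/

section PartialDerivatives

variable {f g : ℝ × ℝ → ℝ} {S : Set (ℝ × ℝ)}

lemma hasDerivAt_comp_prod {a b : ℝ → ℝ} {a' b' t : ℝ} (hf : DifferentiableAt ℝ f (a t, b t))
    (ha : HasDerivAt a a' t) (hb : HasDerivAt b b' t) :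
    HasDerivAt (fun t => f (a t, b t)) (d1 f (a t, b t) * a' + d2 f (a t, b t) * b') t := by
  have h := hf.hasFDerivAt.comp_hasDerivAt t (ha.prodMk hb)
  refine HasDerivAt.congr_deriv (f := fun t => f (a t, b t)) h ?_
  have : ((a', b') : ℝ × ℝ) = a' • (1, 0) + b' • (0, 1) := by simp
  rw [this, map_add, map_smul, map_smul]
  simp only [d1, d2, smul_eq_mul]
  ring

lemma hasDerivAt_fst {q p : ℝ} (hf : DifferentiableAt ℝ f (q, p)) :
    HasDerivAt (fun q => f (q, p)) (d1 f (q, p)) q := by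
  simpa using hasDerivAt_comp_prod (a := id) (b := fun _ => p) hf (hasDerivAt_id q)
    (hasDerivAt_const q p)

lemma hasDerivAt_snd {q p : ℝ} (hf : DifferentiableAt ℝ f (q, p)) :
    HasDerivAt (fun p => f (q, p)) (d2 f (q, p)) p := by
  simpa using hasDerivAt_comp_prod (a := fun _ => q) (b := id) hf (hasDerivAt_const p q)
    (hasDerivAt_id p)

lemma contDiffOn_d2 {m n : WithTop ℕ∞} (hf : ContDiffOn ℝ n f S) (hS : IsOpen S)
    (hmn : m + 1 ≤ n) : ContDiffOn ℝ m (d2 f) S :=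
  (hf.fderiv_of_isOpen hS hmn).clm_apply contDiffOn_const

lemma differentiableAt_of_contDiffOn {n : WithTop ℕ∞} (hf : ContDiffOn ℝ n f S) (hS : IsOpen S)
    (hn : n ≠ 0) {z : ℝ × ℝ} (hz : z ∈ S) : DifferentiableAt ℝ f z :=
  (hf.differentiableOn hn).differentiableAt (hS.mem_nhds hz)

lemma d1_d2_comm (hf : ContDiffOn ℝ 2 f S) (hS : IsOpen S) {z : ℝ × ℝ} (hz : z ∈ S) :
    d1 (d2 f) z = d2 (d1 f) z := by
  have hsymm : IsSymmSndFDerivAt ℝ f z :=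
    (hf.contDiffAt (hS.mem_nhds hz)).isSymmSndFDerivAt (by simp)
  have hd : DifferentiableAt ℝ (fderiv ℝ f) z :=
    ((hf.fderiv_of_isOpen hS (m := 1) (by norm_num)).differentiableOn one_ne_zero).differentiableAt
      (hS.mem_nhds hz)
  have key : ∀ v w : ℝ × ℝ,
      fderiv ℝ (fun y => fderiv ℝ f y v) z w = fderiv ℝ (fderiv ℝ f) z w v := fun v w => by
    rw [fderiv_clm_apply hd (differentiableAt_const v)]
    simp
  exact (key _ _).trans ((hsymm.eq _ _).trans (key _ _).symm)

lemma eqOn_d1 (h : EqOn f g S) (hS : IsOpen S) : EqOn (d1 f) (d1 g) S := fun z hz => by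
  have : f =ᶠ[𝓝 z] g := by filter_upwards [hS.mem_nhds hz] with y hy using h hy
  simp only [d1, this.fderiv_eq]

lemma eqOn_d2 (h : EqOn f g S) (hS : IsOpen S) : EqOn (d2 f) (d2 g) S := fun z hz => by
  have : f =ᶠ[𝓝 z] g := by filter_upwards [hS.mem_nhds hz] with y hy using h hy
  simp only [d2, this.fderiv_eq]

lemma d2_eq_of_eqOn_line {q p : ℝ} (hf : DifferentiableAt ℝ f (q, p))
    (hg : DifferentiableAt ℝ g (q, p)) (h : ∀ᶠ t in 𝓝 p, f (q, t) = g (q, t)) :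
    d2 f (q, p) = d2 g (q, p) :=
  (hasDerivAt_snd hf).unique ((hasDerivAt_snd hg).congr_of_eventuallyEq h)

/-- Symmetry of the mixed derivative `∂_q ∂_p f` when only `∂_q f` is known to be `C¹`. -/
lemma hasDerivAt_d2_fst (hS : IsOpen S) (hf : ∀ z ∈ S, DifferentiableAt ℝ f z)
    (hf1 : ContDiffOn ℝ 1 (d1 f) S) {q p : ℝ} (hz : (q, p) ∈ S) :
    HasDerivAt (fun t => d2 f (t, p)) (d2 (d1 f) (q, p)) q := by
  set κ := d2 (d1 f) (q, p) with hκ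
  have hcont : ContinuousAt (d2 (d1 f)) (q, p) :=
    (contDiffOn_d2 (m := 0) hf1 hS (by norm_num)).continuousOn.continuousAt (hS.mem_nhds hz)
  rw [hasDerivAt_iff_isLittleO, isLittleO_iff]
  intro ε hε
  obtain ⟨r, hr, hball⟩ := Metric.mem_nhds_iff.1
    ((hcont.eventually (Metric.closedBall_mem_nhds κ hε)).and (hS.mem_nhds hz))
  have hrect : ∀ {x y : ℝ}, x ∈ Metric.ball q r → y ∈ Metric.ball p r →
      |d2 (d1 f) (x, y) - κ| ≤ ε ∧ (x, y) ∈ S := fun hx hy => by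
    have := hball (show (_, _) ∈ Metric.ball (q, p) r by
      rw [← ball_prod_same]; exact ⟨hx, hy⟩)
    exact ⟨this.1, this.2⟩
  have hqr : q ∈ Metric.ball q r := Metric.mem_ball_self hr
  have hpr : p ∈ Metric.ball p r := Metric.mem_ball_self hr
  -- first in the vertical, then in the horizontal direction
  have hvert : ∀ x ∈ Metric.ball q r, ∀ y ∈ Metric.ball p r,
      |(d1 f (x, y) - κ * y) - (d1 f (x, p) - κ * p)| ≤ ε * |y - p| := fun x hx y hy =>
    (convex_ball p r).norm_image_sub_le_of_norm_hasDerivWithin_le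
      (f := fun y => d1 f (x, y) - κ * y) (f' := fun y => d2 (d1 f) (x, y) - κ) (C := ε)
      (fun t ht => (((hasDerivAt_snd (differentiableAt_of_contDiffOn hf1 hS one_ne_zero
        (hrect hx ht).2)).sub (by simpa using (hasDerivAt_id t).const_mul κ))).hasDerivWithinAt)
      (fun t ht => (hrect hx ht).1) hpr hy
  have hhor : ∀ x ∈ Metric.ball q r, ∀ y ∈ Metric.ball p r,
      |(f (x, y) - f (x, p) - x * (κ * (y - p))) - (f (q, y) - f (q, p) - q * (κ * (y - p)))|
        ≤ ε * |y - p| * |x - q| := fun x hx y hy =>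
    (convex_ball q r).norm_image_sub_le_of_norm_hasDerivWithin_le
      (f := fun x => f (x, y) - f (x, p) - x * (κ * (y - p)))
      (f' := fun x => d1 f (x, y) - d1 f (x, p) - 1 * (κ * (y - p)))
      (fun t ht => (((hasDerivAt_fst (hf _ (hrect ht hy).2)).sub
        (hasDerivAt_fst (hf _ (hrect ht hpr).2))).sub
          ((hasDerivAt_id t).mul_const _)).hasDerivWithinAt)
      (fun t ht => by
        have := hvert t ht y hy
        rw [Real.norm_eq_abs]
        convert this using 2
        ring) hqr hx
  filter_upwards [Metric.ball_mem_nhds q hr] with x hx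
  have hder : HasDerivAt (fun y => f (x, y) - f (q, y) - (x - q) * (κ * (y - p)))
      (d2 f (x, p) - d2 f (q, p) - (x - q) * (κ * 1)) p :=
    ((hasDerivAt_snd (hf _ (hrect hx hpr).2)).sub (hasDerivAt_snd (hf _ (hrect hqr hpr).2))).sub
      ((((hasDerivAt_id p).sub_const p).const_mul κ).const_mul (x - q))
  -- The double difference of `f`, corrected by its expected main term, is at most ε |x - q| |y -
  -- p|; its y-derivative at `p` is therefore at most ε |x - q|, which is the required little-o
  -- estimate.
  have hle := hder.hasFDerivAt.le_of_lip' (C := ε * |x - q|) (by positivity) (by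
    filter_upwards [Metric.ball_mem_nhds p hr] with y hy
    have := hhor x hx y hy
    rw [Real.norm_eq_abs, Real.norm_eq_abs]
    calc _ = _ := by congr 1; ring
      _ ≤ _ := this
      _ = _ := by ring)
  simp only [ContinuousLinearMap.norm_toSpanSingleton, Real.norm_eq_abs] at hle
  rw [Real.norm_eq_abs, Real.norm_eq_abs]
  convert hle using 2
  simp only [smul_eq_mul, mul_one]

end PartialDerivatives

/-! ### Agreement of functions to a given order at the origin -/

/-- Both functions are continuous at `0`, where they differ by `O(q ^ n)` only. -/
structure AgreeToOrder (n : ℕ) (f g : ℝ → ℝ) : Prop where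
  left : ContinuousAt f 0
  right : ContinuousAt g 0
  sub : (fun q => f q - g q) =O[𝓝 0] fun q : ℝ => q ^ n

namespace AgreeToOrder

variable {n : ℕ} {f g f₁ f₂ g₁ g₂ : ℝ → ℝ}

lemma const (c : ℝ) : AgreeToOrder n (fun _ => c) fun _ => c :=
  ⟨continuousAt_const, continuousAt_const, by simpa using isBigO_zero _ _⟩

lemma add (hf : AgreeToOrder n f₁ f₂) (hg : AgreeToOrder n g₁ g₂) :
    AgreeToOrder n (fun q => f₁ q + g₁ q) fun q => f₂ q + g₂ q :=
  ⟨hf.left.add hg.left, hf.right.add hg.right,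
    (hf.sub.add hg.sub).congr_left fun q => by ring⟩

lemma mul (hf : AgreeToOrder n f₁ f₂) (hg : AgreeToOrder n g₁ g₂) :
    AgreeToOrder n (fun q => f₁ q * g₁ q) fun q => f₂ q * g₂ q := by
  refine ⟨hf.left.mul hg.left, hf.right.mul hg.right, ?_⟩
  have h1 := (hf.left.isBigO_one ℝ).mul hg.sub
  have h2 := hf.sub.mul (hg.right.isBigO_one ℝ)
  simp only [one_mul, mul_one] at h1 h2
  exact (h1.add h2).congr_left fun q => by ring

lemma neg (hf : AgreeToOrder n f g) : AgreeToOrder n (fun q => -f q) fun q => -g q := by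
  simpa using (const (-1)).mul hf

lemma inv (hf : AgreeToOrder n f g) (h1 : f 0 ≠ 0) (h2 : g 0 ≠ 0) :
    AgreeToOrder n (fun q => (f q)⁻¹) fun q => (g q)⁻¹ := by
  refine ⟨hf.left.inv₀ h1, hf.right.inv₀ h2, ?_⟩
  have h := (((hf.left.inv₀ h1).mul (hf.right.inv₀ h2)).isBigO_one ℝ).mul hf.sub.neg_left
  simp only [one_mul] at h
  refine h.congr' ?_ EventuallyEq.rfl
  filter_upwards [hf.left.eventually_ne h1, hf.right.eventually_ne h2] with q hq1 hq2
  simp only [Pi.mul_apply, Pi.inv_apply]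
  field_simp
  ring

/-- With its converse `derivChain_eq`, this trades equality of Taylor coefficients for order of
contact, which passes through products and inverses without a Leibniz formula. -/
lemma of_derivChain {F G : ℕ → ℝ → ℝ} (hF : DerivChain F) (hG : DerivChain G)
    (h : ∀ j < n, F j 0 = G j 0) : AgreeToOrder n (F 0) (G 0) :=
  ⟨(hF.continuous 0).continuousAt, (hG.continuous 0).continuousAt,
    (hF.sub hG).isBigO fun j hj => sub_eq_zero.2 (h j hj)⟩

lemma derivChain_eq {F G : ℕ → ℝ → ℝ} (hF : DerivChain F) (hG : DerivChain G)
    (h : AgreeToOrder n (F 0) (G 0)) (j : ℕ) (hj : j < n) : F j 0 = G j 0 :=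
  sub_eq_zero.1 ((hF.sub hG).eq_zero_of_isBigO h.sub j hj)

end AgreeToOrder

/-! ### Unique continuation for the height equation -/

/-- Solutions of the height equation that are analytic in the horizontal variable. -/
structure AnalyticHeight (a b : ℝ) (γ : ℝ → ℝ) (h : ℝ × ℝ → ℝ) : Prop where
  contDiffOn : ∀ m, ContDiffOn ℝ 2 (d1^[m] h) {z | a < z.2 ∧ z.2 < b}
  bound : ∃ C L : ℝ, 0 < C ∧ 0 < L ∧ ∀ m, ∀ z : ℝ × ℝ, a < z.2 ∧ z.2 < b →
    |d1^[m] h z| ≤ C * L ^ m * m.factorial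
  d2_ne_zero : ∀ z : ℝ × ℝ, a < z.2 ∧ z.2 < b → d2 h z ≠ 0
  equation : ∀ z : ℝ × ℝ, a < z.2 ∧ z.2 < b →
    (1 + d1 h z ^ 2) * d2 (d2 h) z - 2 * d1 h z * d2 h z * d2 (d1 h) z
      + d2 h z ^ 2 * d1 (d1 h) z = γ z.2 * d2 h z ^ 3

lemma isOpen_strip (a b : ℝ) : IsOpen {z : ℝ × ℝ | a < z.2 ∧ z.2 < b} :=
  (isOpen_lt continuous_const continuous_snd).inter (isOpen_lt continuous_snd continuous_const)

namespace AnalyticHeight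

variable {a b : ℝ} {γ : ℝ → ℝ} {h h₁ h₂ : ℝ × ℝ → ℝ}

lemma differentiableAt (hh : AnalyticHeight a b γ h) (m : ℕ) {q p : ℝ} (hp : p ∈ Ioo a b) :
    DifferentiableAt ℝ (d1^[m] h) (q, p) :=
  differentiableAt_of_contDiffOn (hh.contDiffOn m) (isOpen_strip a b) two_ne_zero hp

lemma differentiableAt_d2 (hh : AnalyticHeight a b γ h) (m : ℕ) {q p : ℝ} (hp : p ∈ Ioo a b) :
    DifferentiableAt ℝ (d2 (d1^[m] h)) (q, p) :=
  differentiableAt_of_contDiffOn (contDiffOn_d2 (m := 1) (hh.contDiffOn m) (isOpen_strip a b)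
    (by norm_num)) (isOpen_strip a b) one_ne_zero hp

lemma chain (hh : AnalyticHeight a b γ h) {p : ℝ} (hp : p ∈ Ioo a b) :
    DerivChain fun j q => d1^[j] h (q, p) := fun j q => by
  simpa only [Function.iterate_succ_apply'] using hasDerivAt_fst (hh.differentiableAt j hp)

lemma chain_d2 (hh : AnalyticHeight a b γ h) {p : ℝ} (hp : p ∈ Ioo a b) :
    DerivChain fun j q => d2 (d1^[j] h) (q, p) := fun j q => by
  have := hasDerivAt_fst (hh.differentiableAt_d2 j hp (q := q))
  rw [d1_d2_comm (hh.contDiffOn j) (isOpen_strip a b) hp] at this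
  simpa only [Function.iterate_succ_apply'] using this

/-- Here ∂_p ∂_q^j h is known to be only C¹, so the symmetry of its second derivatives is not
available directly. Its q-derivative ∂_p ∂_q^(j+1) h is again C¹, and `hasDerivAt_d2_fst` needs no
more. -/
lemma chain_d2_d2 (hh : AnalyticHeight a b γ h) {p : ℝ} (hp : p ∈ Ioo a b) :
    DerivChain fun j q => d2 (d2 (d1^[j] h)) (q, p) := fun j q => by
  have hS := isOpen_strip a b
  have heq : EqOn (d1 (d2 (d1^[j] h))) (d2 (d1^[j + 1] h)) {z : ℝ × ℝ | a < z.2 ∧ z.2 < b} :=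
    fun z hz => by
      rw [Function.iterate_succ_apply', d1_d2_comm (hh.contDiffOn j) hS hz]
  have hC1 : ContDiffOn ℝ 1 (d2 (d1^[j + 1] h)) {z : ℝ × ℝ | a < z.2 ∧ z.2 < b} :=
    contDiffOn_d2 (hh.contDiffOn (j + 1)) hS (by norm_num)
  have := hasDerivAt_d2_fst (f := d2 (d1^[j] h)) hS
    (fun z hz => hh.differentiableAt_d2 j (q := z.1) (p := z.2) hz) (hC1.congr heq)
    (q := q) (p := p) hp
  rwa [eqOn_d2 heq hS (x := (q, p)) hp] at this

/-- The height equation solved for `h_qq`. -/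
lemma d1_d1_eq (hh : AnalyticHeight a b γ h) {p : ℝ} (hp : p ∈ Ioo a b) (q : ℝ) :
    d1 (d1 h) (q, p) = γ p * d2 h (q, p) + (2 * (d1 h (q, p) * (d2 h (q, p) * d2 (d1 h) (q, p)))
      + -((1 + d1 h (q, p) * d1 h (q, p)) * d2 (d2 h) (q, p)))
        * ((d2 h (q, p))⁻¹ * (d2 h (q, p))⁻¹) := by
  have h1 := hh.equation (q, p) hp
  have h2 := hh.d2_ne_zero (q, p) hp
  field_simp
  linear_combination h1

lemma iterate_d1_eq (hh₁ : AnalyticHeight a b γ h₁) (hh₂ : AnalyticHeight a b γ h₂)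
    (h0 : ∀ p ∈ Ioo a b, h₁ (0, p) = h₂ (0, p))
    (h1 : ∀ p ∈ Ioo a b, d1 h₁ (0, p) = d1 h₂ (0, p)) :
    ∀ n, ∀ j ≤ n + 1, ∀ p ∈ Ioo a b, d1^[j] h₁ (0, p) = d1^[j] h₂ (0, p) := by
  intro n
  induction n with
  | zero =>
    intro j hj p hp
    interval_cases j
    exacts [h0 p hp, h1 p hp]
  | succ n ih =>
    intro j hj p hp
    rcases hj.lt_or_eq with hj | rfl
    · exact ih j (Nat.lt_succ_iff.1 hj) p hp
    -- The induction hypothesis holds for all `p`, so it can be differentiated along q = 0.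
    have hY : ∀ j ≤ n + 1, ∀ p ∈ Ioo a b, d2 (d1^[j] h₁) (0, p) = d2 (d1^[j] h₂) (0, p) :=
      fun j hj p hp => d2_eq_of_eqOn_line (hh₁.differentiableAt j hp) (hh₂.differentiableAt j hp)
        (by filter_upwards [Ioo_mem_nhds hp.1 hp.2] with t ht using ih j hj t ht)
    have hZ : ∀ j ≤ n + 1, d2 (d2 (d1^[j] h₁)) (0, p) = d2 (d2 (d1^[j] h₂)) (0, p) :=
      fun j hj => d2_eq_of_eqOn_line (hh₁.differentiableAt_d2 j hp)
        (hh₂.differentiableAt_d2 j hp)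
        (by filter_upwards [Ioo_mem_nhds hp.1 hp.2] with t ht using hY j hj t ht)
    have A : AgreeToOrder (n + 1) (fun q => d1 h₁ (q, p)) fun q => d1 h₂ (q, p) :=
      .of_derivChain ((hh₁.chain hp).shift 1) ((hh₂.chain hp).shift 1)
        fun j hj => ih (j + 1) (by omega) p hp
    have B : AgreeToOrder (n + 1) (fun q => d2 h₁ (q, p)) fun q => d2 h₂ (q, p) :=
      .of_derivChain (hh₁.chain_d2 hp) (hh₂.chain_d2 hp) fun j hj => hY j hj.le p hp
    have D : AgreeToOrder (n + 1) (fun q => d2 (d1 h₁) (q, p)) fun q => d2 (d1 h₂) (q, p) :=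
      .of_derivChain ((hh₁.chain_d2 hp).shift 1) ((hh₂.chain_d2 hp).shift 1)
        fun j hj => hY (j + 1) (by omega) p hp
    have E : AgreeToOrder (n + 1) (fun q => d2 (d2 h₁) (q, p)) fun q => d2 (d2 h₂) (q, p) :=
      .of_derivChain (hh₁.chain_d2_d2 hp) (hh₂.chain_d2_d2 hp) fun j hj => hZ j hj.le
    have I := B.inv (hh₁.d2_ne_zero (0, p) hp) (hh₂.d2_ne_zero (0, p) hp)
    -- This mirrors the right-hand side of `d1_d1_eq` term by term. Contact of order `n + 1` for
    -- h_qq gives its derivatives of order at most `n`, that is, order `n + 2` for h.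
    have X := ((AgreeToOrder.const (γ p)).mul B).add
      (((((AgreeToOrder.const 2).mul (A.mul (B.mul D)))).add
        (((AgreeToOrder.const 1).add (A.mul A)).mul E).neg).mul (I.mul I))
    simp only [← hh₁.d1_d1_eq hp, ← hh₂.d1_d1_eq hp] at X
    exact AgreeToOrder.derivChain_eq ((hh₁.chain hp).shift 2) ((hh₂.chain hp).shift 2) X n
      (Nat.lt_succ_self n)

/-- A solution is determined by its Cauchy data on the line `q = 0`. -/
theorem eqOn (hh₁ : AnalyticHeight a b γ h₁) (hh₂ : AnalyticHeight a b γ h₂)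
    (h0 : ∀ p ∈ Ioo a b, h₁ (0, p) = h₂ (0, p))
    (h1 : ∀ p ∈ Ioo a b, d1 h₁ (0, p) = d1 h₂ (0, p)) :
    EqOn h₁ h₂ {z | a < z.2 ∧ z.2 < b} := by
  rintro ⟨q, p⟩ hp
  obtain ⟨C₁, L₁, hC₁, hL₁, hb₁⟩ := hh₁.bound
  obtain ⟨C₂, L₂, hC₂, hL₂, hb₂⟩ := hh₂.bound
  refine sub_eq_zero.1 (((hh₁.chain hp).sub (hh₂.chain hp)).eq_zero_of_bound (C := C₁ + C₂)
    (L := max L₁ L₂) (a := 0) (lt_max_of_lt_left hL₁) (fun m q => ?_)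
    (fun m => sub_eq_zero.2 (iterate_d1_eq hh₁ hh₂ h0 h1 m m (Nat.le_succ m) p hp)) q)
  calc |d1^[m] h₁ (q, p) - d1^[m] h₂ (q, p)| ≤ |d1^[m] h₁ (q, p)| + |d1^[m] h₂ (q, p)| :=
        abs_sub _ _
    _ ≤ C₁ * L₁ ^ m * m.factorial + C₂ * L₂ ^ m * m.factorial :=
        add_le_add (hb₁ m _ hp) (hb₂ m _ hp)
    _ ≤ C₁ * max L₁ L₂ ^ m * m.factorial + C₂ * max L₁ L₂ ^ m * m.factorial := by
        gcongr
        exacts [le_max_left _ _, le_max_right _ _]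
    _ = _ := by ring

end AnalyticHeight

end WaterWave

namespace WaterWave.Flow

open Set Filter Topology

variable {W : Flow} {g σ α : ℝ}

namespace IsSymmetricWave

/-! ### The fluid domain -/

lemma contDiff_η (hW : W.IsSymmetricWave g σ α) : ContDiff ℝ 2 W.η :=
  contDiffOn_univ.1 hW.η_mem.choose_spec.contDiffOn

lemma hasDerivAt_η (hW : W.IsSymmetricWave g σ α) (x : ℝ) : HasDerivAt W.η (deriv W.η x) x :=
  (hW.contDiff_η.differentiable two_ne_zero x).hasDerivAt

lemma isOpen_domain (hW : W.IsSymmetricWave g σ α) : IsOpen W.domain := by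
  have h2 : IsOpen {z : ℝ × ℝ | z.2 < W.η z.1} :=
    isOpen_lt continuous_snd (hW.contDiff_η.continuous.comp continuous_fst)
  have h1 : IsOpen {z : ℝ × ℝ | W.bed < (z.2 : WithBot ℝ)} := by
    induction W.bed using WithBot.recBotCoe with
    | bot => simp
    | coe b => simpa using isOpen_lt continuous_const continuous_snd
  exact h1.inter h2

lemma domain_subset : W.domain ⊆ W.closedDomain := fun _ hz => ⟨hz.1.le, hz.2.le⟩

lemma mem_closedDomain_of_le {x y y' : ℝ} (h : (x, y) ∈ W.closedDomain) (h1 : y ≤ y')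
    (h2 : y' ≤ W.η x) : (x, y') ∈ W.closedDomain :=
  ⟨h.1.trans (WithBot.coe_le_coe.2 h1), h2⟩

lemma mem_domain_of_lt {x y y' : ℝ} (h : (x, y) ∈ W.closedDomain) (h1 : y < y')
    (h2 : y' < W.η x) : (x, y') ∈ W.domain :=
  ⟨h.1.trans_lt (WithBot.coe_lt_coe.2 h1), h2⟩

lemma surface_mem (hW : W.IsSymmetricWave g σ α) (x : ℝ) : (x, W.η x) ∈ W.closedDomain :=
  ⟨(hW.bed_lt x).le, le_rfl⟩

lemma exists_lt_surface (hW : W.IsSymmetricWave g σ α) (x : ℝ) :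
    ∃ c < W.η x, (x, c) ∈ W.closedDomain := by
  rcases hb : W.bed with _ | b
  · exact ⟨W.η x - 1, by linarith, by rw [hb]; exact bot_le, by simp⟩
  · have h := hW.bed_lt x
    rw [hb] at h
    have h' : b < W.η x := WithBot.coe_lt_coe.1 h
    exact ⟨b, h', hb.le, h'.le⟩

lemma continuousOn_line {f : ℝ × ℝ → ℝ} (hf : ContinuousOn f W.closedDomain) {x y : ℝ}
    (h : (x, y) ∈ W.closedDomain) : ContinuousOn (fun s => f (x, s)) (Icc y (W.η x)) :=
  hf.comp (by fun_prop) fun _ hs => mem_closedDomain_of_le h hs.1 hs.2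

lemma exists_u_le (hW : W.IsSymmetricWave g σ α) :
    ∃ δ : ℝ, 0 < δ ∧ ∀ z ∈ W.closedDomain, W.u z ≤ -δ := by
  obtain ⟨δ, hδ, hu⟩ := hW.no_stagnation
  refine ⟨δ, hδ, ?_⟩
  rintro ⟨x, y⟩ hz
  -- A vertical segment of positive length is needed, so that its boundary points are limits of
  -- points of the open domain.
  obtain ⟨c, hc, hcm, hyc⟩ : ∃ c < W.η x, (x, c) ∈ W.closedDomain ∧ c ≤ y := by
    rcases (show y ≤ W.η x from hz.2).lt_or_eq with h | h
    · exact ⟨y, h, hz, le_rfl⟩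
    · obtain ⟨c, hc, hcm⟩ := hW.exists_lt_surface x
      exact ⟨c, hc, hcm, h ▸ hc.le⟩
  have hcl : closure (Ioo c (W.η x)) = Icc c (W.η x) := closure_Ioo hc.ne
  exact le_on_closure (f := fun s => W.u (x, s)) (g := fun _ => -δ) (s := Ioo c (W.η x))
    (fun s hs => hu _ (mem_domain_of_lt hcm hs.1 hs.2))
    (hcl ▸ continuousOn_line hW.u_cont hcm) continuousOn_const (hcl ▸ ⟨hyc, hz.2⟩)

lemma differentiableAt_u (hW : W.IsSymmetricWave g σ α) {z : ℝ × ℝ} (hz : z ∈ W.domain) :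
    DifferentiableAt ℝ W.u z :=
  differentiableAt_of_contDiffOn hW.u_mem.choose_spec.contDiffOn hW.isOpen_domain (by norm_num) hz

lemma differentiableAt_v (hW : W.IsSymmetricWave g σ α) {z : ℝ × ℝ} (hz : z ∈ W.domain) :
    DifferentiableAt ℝ W.v z :=
  differentiableAt_of_contDiffOn hW.v_mem.choose_spec.contDiffOn hW.isOpen_domain (by norm_num) hz

lemma differentiableAt_P (hW : W.IsSymmetricWave g σ α) {z : ℝ × ℝ} (hz : z ∈ W.domain) :
    DifferentiableAt ℝ W.P z :=
  differentiableAt_of_contDiffOn hW.P_contDiffOn hW.isOpen_domain one_ne_zero hz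

/-! ### The stream function -/

lemma stream_surface (x : ℝ) : W.stream (x, W.η x) = 0 := by simp [stream]

lemma stream_sub (hW : W.IsSymmetricWave g σ α) {x y y' : ℝ} (h : (x, y) ∈ W.closedDomain)
    (h1 : y ≤ y') (h2 : y' ≤ W.η x) :
    W.stream (x, y) - W.stream (x, y') = -∫ s in y..y', W.u (x, s) := by
  have hc := continuousOn_line hW.u_cont h
  have i1 : IntervalIntegrable (fun s => W.u (x, s)) MeasureTheory.volume y y' :=
    (hc.mono (Icc_subset_Icc_right h2)).intervalIntegrable_of_Icc h1
  have i2 : IntervalIntegrable (fun s => W.u (x, s)) MeasureTheory.volume y' (W.η x) :=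
    (hc.mono (Icc_subset_Icc_left h1)).intervalIntegrable_of_Icc h2
  have := intervalIntegral.integral_add_adjacent_intervals i1 i2
  simp only [stream]
  linarith

/-- Integrating u ≤ -δ shows that ψ decreases upwards at rate at least δ; injectivity of the
hodograph transform and control of heights by stream values follow. -/
lemma mul_sub_le_stream_sub (hW : W.IsSymmetricWave g σ α) {δ : ℝ}
    (hδ : ∀ z ∈ W.closedDomain, W.u z ≤ -δ) {x y y' : ℝ} (h : (x, y) ∈ W.closedDomain)
    (h1 : y ≤ y') (h2 : y' ≤ W.η x) :
    δ * (y' - y) ≤ W.stream (x, y) - W.stream (x, y') := by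
  have hc := continuousOn_line hW.u_cont h
  have := intervalIntegral.integral_mono_on h1
    ((hc.mono (Icc_subset_Icc_right h2)).intervalIntegrable_of_Icc h1)
    (intervalIntegrable_const (c := -δ) (μ := MeasureTheory.volume))
    fun s hs => hδ _ (mem_closedDomain_of_le h hs.1 (hs.2.trans h2))
  rw [intervalIntegral.integral_const, smul_eq_mul] at this
  rw [hW.stream_sub h h1 h2]
  linarith

lemma mul_abs_sub_le (hW : W.IsSymmetricWave g σ α) {δ : ℝ}
    (hδ : ∀ z ∈ W.closedDomain, W.u z ≤ -δ) {x y y' : ℝ} (h : (x, y) ∈ W.closedDomain)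
    (h' : (x, y') ∈ W.closedDomain) :
    δ * |y - y'| ≤ |W.stream (x, y) - W.stream (x, y')| := by
  rcases le_total y y' with hle | hle
  · have := hW.mul_sub_le_stream_sub hδ h hle h'.2
    rw [abs_sub_comm, abs_of_nonneg (sub_nonneg.2 hle)]
    exact this.trans (le_abs_self _)
  · have := hW.mul_sub_le_stream_sub hδ h' hle h.2
    rw [abs_of_nonneg (sub_nonneg.2 hle), abs_sub_comm (W.stream _)]
    exact this.trans (le_abs_self _)

lemma stream_lt (hW : W.IsSymmetricWave g σ α) {x y y' : ℝ} (h : (x, y) ∈ W.closedDomain)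
    (h1 : y < y') (h2 : y' ≤ W.η x) : W.stream (x, y') < W.stream (x, y) := by
  obtain ⟨δ, hδ, hu⟩ := hW.exists_u_le
  have := hW.mul_sub_le_stream_sub hu h h1.le h2
  nlinarith [mul_pos hδ (sub_pos.2 h1)]

lemma injOn_hodograph (hW : W.IsSymmetricWave g σ α) : InjOn W.hodograph W.closedDomain := by
  rintro ⟨x, y⟩ hz ⟨x', y'⟩ hz' h
  simp only [hodograph, Prod.mk.injEq, neg_inj] at h
  obtain ⟨rfl, h⟩ := h
  obtain ⟨δ, hδ, hu⟩ := hW.exists_u_le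
  have := hW.mul_abs_sub_le hu hz hz'
  rw [h, sub_self, abs_zero] at this
  have : |y - y'| ≤ 0 := by
    by_contra! hlt
    nlinarith [mul_pos hδ hlt]
  rw [sub_eq_zero.1 (abs_nonpos_iff.1 this)]

lemma hodographInv_hodograph (hW : W.IsSymmetricWave g σ α) {z : ℝ × ℝ}
    (hz : z ∈ W.closedDomain) : W.hodographInv (W.hodograph z) = z :=
  hW.injOn_hodograph.leftInvOn_invFunOn hz

lemma continuousOn_stream_line (hW : W.IsSymmetricWave g σ α) {x y : ℝ}
    (h : (x, y) ∈ W.closedDomain) :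
    ContinuousOn (fun s => W.stream (x, s)) (Icc y (W.η x)) := by
  have hle : y ≤ W.η x := h.2
  have hc : ContinuousOn (fun s => W.u (x, s)) (uIcc y (W.η x)) := by
    rw [uIcc_of_le hle]
    exact continuousOn_line hW.u_cont h
  have := intervalIntegral.continuousOn_primitive_interval_left
    (hc.integrableOn_compact isCompact_uIcc (μ := MeasureTheory.volume))
  rw [uIcc_of_le hle] at this
  exact this.neg

lemma hasDerivAt_stream (hW : W.IsSymmetricWave g σ α) {x y : ℝ} (h : (x, y) ∈ W.domain) :
    HasDerivAt (fun s => W.stream (x, s)) (W.u (x, y)) y := by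
  have hopen : IsOpen {s : ℝ | (x, s) ∈ W.domain} := hW.isOpen_domain.preimage (by fun_prop)
  have hco : ContinuousOn (fun s => W.u (x, s)) {s : ℝ | (x, s) ∈ W.domain} :=
    hW.u_cont.comp (by fun_prop) fun s hs => domain_subset hs
  have := intervalIntegral.integral_hasDerivAt_left
    ((continuousOn_line hW.u_cont (domain_subset h)).intervalIntegrable_of_Icc
      (μ := MeasureTheory.volume) h.2.le)
    (hco.stronglyMeasurableAtFilter hopen y h) (hco.continuousAt (hopen.mem_nhds h))
  exact (neg_neg (W.u (x, y))) ▸ this.neg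

/-- An impermeable bed is a streamline. -/
lemma stream_bed (hW : W.IsSymmetricWave g σ α) {b : ℝ} (hb : W.bed = (b : WithBot ℝ)) (x : ℝ) :
    W.stream (x, b) = W.stream (0, b) := by
  have hbη : ∀ x, b < W.η x := fun x => WithBot.coe_lt_coe.1 (hb ▸ hW.bed_lt x)
  -- The map (x, s) ↦ (x, φ(x, s)) straightens the fluid domain to 0 ≤ s ≤ 1, and (f, k) below is
  -- the velocity field transformed so that its divergence is (η - b)(u_x + v_y) = 0.
  set φ : ℝ × ℝ → ℝ := fun z => b + (W.η z.1 - b) * z.2 with hφ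
  have hη : Continuous W.η := hW.contDiff_η.continuous
  have hη' : Continuous (deriv W.η) := hW.contDiff_η.continuous_deriv (by norm_num)
  have hmem : ∀ z : ℝ × ℝ, z.2 ∈ Icc (0 : ℝ) 1 → (z.1, φ z) ∈ W.closedDomain := fun z hz => by
    have := mul_nonneg (sub_pos.2 (hbη z.1)).le hz.1
    have := mul_le_mul_of_nonneg_left hz.2 (sub_pos.2 (hbη z.1)).le
    refine ⟨?_, ?_⟩
    · rw [hb]
      exact WithBot.coe_le_coe.2 (by simp only [hφ]; linarith)
    · simp only [hφ]; linarith
  have hmem' : ∀ z : ℝ × ℝ, z.2 ∈ Ioo (0 : ℝ) 1 → (z.1, φ z) ∈ W.domain := fun z hz => by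
    have := mul_pos (sub_pos.2 (hbη z.1)) hz.1
    have := mul_lt_mul_of_pos_left hz.2 (sub_pos.2 (hbη z.1))
    refine ⟨?_, ?_⟩
    · rw [hb]
      exact WithBot.coe_lt_coe.2 (by simp only [hφ]; linarith)
    · simp only [hφ]; linarith
  have hφc : Continuous φ := by fun_prop
  have hΦc : ContinuousOn (fun z : ℝ × ℝ => (z.1, φ z)) {z | z.2 ∈ Icc (0 : ℝ) 1} :=
    (continuous_fst.prodMk hφc).continuousOn
  set f : ℝ × ℝ → ℝ := fun z => W.u (z.1, φ z) * (W.η z.1 - b) with hf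
  set k : ℝ × ℝ → ℝ := fun z => W.v (z.1, φ z) - W.u (z.1, φ z) * (z.2 * deriv W.η z.1) with hk
  have hfc : ContinuousOn f {z | z.2 ∈ Icc (0 : ℝ) 1} :=
    (hW.u_cont.comp hΦc hmem).mul (by fun_prop)
  have hkc : ContinuousOn k {z | z.2 ∈ Icc (0 : ℝ) 1} :=
    (hW.v_cont.comp hΦc hmem).sub ((hW.u_cont.comp hΦc hmem).mul (by fun_prop))
  have hηd : Differentiable ℝ W.η := hW.contDiff_η.differentiable two_ne_zero
  have hηd' : Differentiable ℝ (deriv W.η) := hW.contDiff_η.differentiable_deriv_two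
  have hφd : Differentiable ℝ φ := by fun_prop
  have hΦd : Differentiable ℝ (fun z : ℝ × ℝ => (z.1, φ z)) := differentiable_fst.prodMk hφd
  have hud : ∀ z : ℝ × ℝ, z.2 ∈ Ioo (0 : ℝ) 1 →
      DifferentiableAt ℝ (fun z : ℝ × ℝ => W.u (z.1, φ z)) z := fun z hz =>
    (hW.differentiableAt_u (hmem' z hz)).comp (f := fun z : ℝ × ℝ => (z.1, φ z)) z (hΦd z)
  have hvd : ∀ z : ℝ × ℝ, z.2 ∈ Ioo (0 : ℝ) 1 →
      DifferentiableAt ℝ (fun z : ℝ × ℝ => W.v (z.1, φ z)) z := fun z hz =>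
    (hW.differentiableAt_v (hmem' z hz)).comp (f := fun z : ℝ × ℝ => (z.1, φ z)) z (hΦd z)
  have hfd : ∀ z : ℝ × ℝ, z.2 ∈ Ioo (0 : ℝ) 1 → DifferentiableAt ℝ f z := fun z hz =>
    (hud z hz).mul (by fun_prop)
  have hkd : ∀ z : ℝ × ℝ, z.2 ∈ Ioo (0 : ℝ) 1 → DifferentiableAt ℝ k z := fun z hz =>
    (hvd z hz).sub ((hud z hz).mul (by fun_prop))
  have hdiv : ∀ z : ℝ × ℝ, z.2 ∈ Ioo (0 : ℝ) 1 → d1 f z + d2 k z = 0 := by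
    rintro ⟨x, s⟩ hz
    have hdom := hmem' (x, s) hz
    have e1 : d1 f (x, s) = _ := (hasDerivAt_fst (hfd _ hz)).unique
      ((hasDerivAt_comp_prod (b := fun x => b + (W.η x - b) * s) (hW.differentiableAt_u hdom)
        (hasDerivAt_id x) ((((hW.hasDerivAt_η x).sub_const b).mul_const s).const_add b)).mul
          ((hW.hasDerivAt_η x).sub_const b))
    have hy : HasDerivAt (fun s => b + (W.η x - b) * s) ((W.η x - b) * 1) s :=
      ((hasDerivAt_id s).const_mul (W.η x - b)).const_add b
    have e2 : d2 k (x, s) = _ := (hasDerivAt_snd (hkd _ hz)).unique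
      ((hasDerivAt_comp_prod (a := fun _ => x) (b := fun s => b + (W.η x - b) * s)
          (hW.differentiableAt_v hdom)
        (hasDerivAt_const s x) hy).sub
        ((hasDerivAt_comp_prod (a := fun _ => x) (b := fun s => b + (W.η x - b) * s)
          (hW.differentiableAt_u hdom)
          (hasDerivAt_const s x) hy).mul ((hasDerivAt_id s).mul_const (deriv W.η x))))
    have hinc := hW.incompressible _ hdom
    rw [e1, e2]
    simp only [hφ, id] at hinc ⊢
    linear_combination (W.η x - b) * hinc
  have hstream : ∀ x, ∫ s in (0 : ℝ)..1, f (x, s) = -W.stream (x, b) := fun x => by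
    have := intervalIntegral.smul_integral_comp_add_mul (a := 0) (b := 1) (fun y => W.u (x, y))
      (W.η x - b) b
    simp only [mul_zero, add_zero, mul_one, add_sub_cancel, smul_eq_mul] at this
    simp only [hf, hφ, stream, neg_neg, ← this]
    rw [intervalIntegral.integral_mul_const, mul_comm]
  classical
  -- Off the open strip the derivatives are replaced by 0, so the divergence vanishes everywhere and
  -- its integrability is trivial.
  set f' : ℝ × ℝ → ℝ × ℝ →L[ℝ] ℝ := fun z => if z.2 ∈ Ioo (0 : ℝ) 1 then fderiv ℝ f z else 0
  set k' : ℝ × ℝ → ℝ × ℝ →L[ℝ] ℝ := fun z => if z.2 ∈ Ioo (0 : ℝ) 1 then fderiv ℝ k z else 0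
  have hzero : ∀ z, f' z (1, 0) + k' z (0, 1) = 0 := fun z => by
    by_cases hz : z.2 ∈ Ioo (0 : ℝ) 1
    · simp only [f', k', if_pos hz]
      exact hdiv z hz
    · simp only [f', k', if_neg hz, zero_apply, add_zero]
  have hsub : uIcc 0 x ×ˢ uIcc (0 : ℝ) 1 ⊆ {z | z.2 ∈ Icc (0 : ℝ) 1} :=
    fun z hz => by
      have := hz.2
      rwa [uIcc_of_le zero_le_one] at this
  have hsub' : ∀ z ∈ Ioo (min 0 x) (max 0 x) ×ˢ Ioo (min (0 : ℝ) 1) (max 0 1) \ ∅,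
      z.2 ∈ Ioo (0 : ℝ) 1 := fun z hz => by
    have := hz.1.2
    rwa [min_eq_left zero_le_one, max_eq_right zero_le_one] at this
  have key := MeasureTheory.integral2_divergence_prod_of_hasFDerivAt_off_countable f k f' k'
    0 0 x 1 ∅ countable_empty (hfc.mono hsub) (hkc.mono hsub)
    (fun z hz => by
      simp only [f', if_pos (hsub' z hz)]
      exact (hfd z (hsub' z hz)).hasFDerivAt)
    (fun z hz => by
      simp only [k', if_pos (hsub' z hz)]
      exact (hkd z (hsub' z hz)).hasFDerivAt)
    (by simp only [hzero]; exact MeasureTheory.integrableOn_zero)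
  -- No flux crosses the surface (kinematic condition) or the bed (impermeability), so the flux
  -- through vertical sections is constant.
  have hk1 : ∀ x, k (x, 1) = 0 := fun x => by
    simp only [hk, hφ, mul_one, one_mul, add_sub_cancel, hW.kinematic, sub_self]
  have hk0 : ∀ x, k (x, 0) = 0 := fun x => by
    simp only [hk, hφ, mul_zero, zero_mul, add_zero, hW.impermeable b hb, sub_self]
  simp only [hzero, hk1, hk0, hstream, intervalIntegral.integral_zero] at key
  linarith

/-! ### The height function in a surface layer -/

variable {y₀ : ℝ}

/-- Every vertical line reaches down to the streamline through (0, y₀), so the height function is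
meaningful on the whole strip. In infinite depth ψ grows at least linearly with depth; in finite
depth the bed is a streamline. -/
lemma exists_le_stream (hW : W.IsSymmetricWave g σ α) (h0 : (0, y₀) ∈ W.closedDomain) (q : ℝ) :
    ∃ y, (q, y) ∈ W.closedDomain ∧ W.stream (0, y₀) ≤ W.stream (q, y) := by
  rcases hb : W.bed with _ | b
  · obtain ⟨δ, hδ, hu⟩ := hW.exists_u_le
    set m := max (W.stream (0, y₀)) 0
    have hm : 0 ≤ m / δ := div_nonneg (le_max_right _ _) hδ.le
    have hmem : (q, W.η q - m / δ) ∈ W.closedDomain := ⟨by rw [hb]; exact bot_le, by simpa⟩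
    refine ⟨_, hmem, (le_max_left _ 0).trans ?_⟩
    have := hW.mul_sub_le_stream_sub hu hmem (by linarith : W.η q - m / δ ≤ W.η q) le_rfl
    rw [stream_surface, sub_sub_cancel, mul_div_cancel₀ _ hδ.ne', sub_zero] at this
    exact this
  · have hb' : W.bed = (b : WithBot ℝ) := hb
    have hbm : ∀ x, (x, b) ∈ W.closedDomain := fun x =>
      ⟨hb'.le, (WithBot.coe_lt_coe.1 (hb' ▸ hW.bed_lt x)).le⟩
    refine ⟨b, hbm q, ?_⟩
    rw [hW.stream_bed hb']
    have hle : b ≤ y₀ := by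
      have := h0.1
      rw [hb'] at this
      exact WithBot.coe_le_coe.1 this
    rcases hle.eq_or_lt with h | h
    · rw [h]
    · exact (hW.stream_lt (hbm 0) h h0.2).le

lemma exists_stream_eq (hW : W.IsSymmetricWave g σ α) (h0 : (0, y₀) ∈ W.closedDomain) (q : ℝ)
    {p : ℝ} (hp : p ∈ Icc (-W.stream (0, y₀)) 0) :
    ∃ y, (q, y) ∈ W.closedDomain ∧ W.stream (q, y) = -p := by
  obtain ⟨c, hc, hcs⟩ := hW.exists_le_stream h0 q
  obtain ⟨y, hy, hys⟩ := intermediate_value_Icc' hc.2 (hW.continuousOn_stream_line hc)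
    (show -p ∈ Icc _ _ from ⟨by simpa [stream_surface] using hp.2, by linarith [hp.1]⟩)
  exact ⟨y, mem_closedDomain_of_le hc hy.1 hy.2, hys⟩

lemma height_eq (hW : W.IsSymmetricWave g σ α) {q y p : ℝ} (h : (q, y) ∈ W.closedDomain)
    (hp : W.stream (q, y) = -p) : W.height (q, p) = y := by
  have := hW.hodographInv_hodograph h
  rw [hodograph, hp, neg_neg] at this
  simp [height, this]

lemma hodographInv_eq (hW : W.IsSymmetricWave g σ α) (h0 : (0, y₀) ∈ W.closedDomain) (q : ℝ)
    {p : ℝ} (hp : p ∈ Icc (-W.stream (0, y₀)) 0) :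
    W.hodographInv (q, p) = (q, W.height (q, p)) := by
  obtain ⟨y, hy, hys⟩ := hW.exists_stream_eq h0 q hp
  rw [hW.height_eq hy hys]
  have := hW.hodographInv_hodograph hy
  rwa [hodograph, hys, neg_neg] at this

lemma height_mem_closedDomain (hW : W.IsSymmetricWave g σ α) (h0 : (0, y₀) ∈ W.closedDomain)
    (q : ℝ) {p : ℝ} (hp : p ∈ Icc (-W.stream (0, y₀)) 0) :
    (q, W.height (q, p)) ∈ W.closedDomain := by
  obtain ⟨y, hy, hys⟩ := hW.exists_stream_eq h0 q hp
  rwa [hW.height_eq hy hys]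

lemma stream_height (hW : W.IsSymmetricWave g σ α) (h0 : (0, y₀) ∈ W.closedDomain) (q : ℝ)
    {p : ℝ} (hp : p ∈ Icc (-W.stream (0, y₀)) 0) : W.stream (q, W.height (q, p)) = -p := by
  obtain ⟨y, hy, hys⟩ := hW.exists_stream_eq h0 q hp
  rwa [hW.height_eq hy hys]

lemma height_mem_domain (hW : W.IsSymmetricWave g σ α) (h0 : (0, y₀) ∈ W.closedDomain) (q : ℝ)
    {p : ℝ} (hp : p ∈ Ioo (-W.stream (0, y₀)) 0) : (q, W.height (q, p)) ∈ W.domain := by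
  have hp' := Ioo_subset_Icc_self hp
  have hm := hW.height_mem_closedDomain h0 q hp'
  have hs := hW.stream_height h0 q hp'
  obtain ⟨c, hc, hcs⟩ := hW.exists_le_stream h0 q
  have hlt : c < W.height (q, p) := by
    by_contra! hle
    rcases hle.eq_or_lt with h | h
    · rw [h] at hs
      linarith [hp.1]
    · have := hW.stream_lt hm h hc.2
      linarith [hp.1]
  refine mem_domain_of_lt hc hlt (lt_of_le_of_ne hm.2 fun h => ?_)
  change W.height (q, p) = W.η q at h
  rw [h, stream_surface] at hs
  linarith [hp.2]

end IsSymmetricWave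

end WaterWave.Flow

/-! ### Streamlines, Bernoulli's law and derivation of the height equation. -/

namespace WaterWave.Flow

open Set Filter Topology

variable {W : Flow} {g σ α y₀ : ℝ}

namespace HeightAnalytic

variable {p₀ : ℝ}

lemma contDiffOn_iterate (hA : W.HeightAnalytic α p₀) (m : ℕ) :
    ContDiffOn ℝ 2 (d1^[m] W.height) {z | p₀ < z.2 ∧ z.2 < 0} := by
  obtain ⟨C, L, -, -, h⟩ := hA
  exact (h m).contDiffOn

lemma exists_abs_le (hA : W.HeightAnalytic α p₀) :
    ∃ C L : ℝ, 0 < C ∧ 0 < L ∧ ∀ m, ∀ z : ℝ × ℝ, p₀ < z.2 ∧ z.2 < 0 →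
      |d1^[m] W.height z| ≤ C * L ^ m * m.factorial := by
  obtain ⟨C, L, hC, hL, h⟩ := hA
  refine ⟨C, L, hC, hL, fun m z hz => ?_⟩
  have := (h m).bound 0 (Nat.zero_le _) z hz
  rwa [norm_iteratedFDeriv_zero] at this

lemma differentiableAt (hA : W.HeightAnalytic α p₀) {q p : ℝ} (hp : p ∈ Ioo p₀ 0) :
    DifferentiableAt ℝ W.height (q, p) :=
  differentiableAt_of_contDiffOn (hA.contDiffOn_iterate 0) (isOpen_strip p₀ 0) two_ne_zero hp

lemma differentiableAt_d1 (hA : W.HeightAnalytic α p₀) {q p : ℝ} (hp : p ∈ Ioo p₀ 0) :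
    DifferentiableAt ℝ (d1 W.height) (q, p) :=
  differentiableAt_of_contDiffOn (hA.contDiffOn_iterate 1) (isOpen_strip p₀ 0) two_ne_zero hp

lemma differentiableAt_d2 (hA : W.HeightAnalytic α p₀) {q p : ℝ} (hp : p ∈ Ioo p₀ 0) :
    DifferentiableAt ℝ (d2 W.height) (q, p) :=
  differentiableAt_of_contDiffOn (contDiffOn_d2 (m := 1) (hA.contDiffOn_iterate 0)
    (isOpen_strip p₀ 0) (by norm_num)) (isOpen_strip p₀ 0) one_ne_zero hp

lemma d1_d2_height (hA : W.HeightAnalytic α p₀) {q p : ℝ} (hp : p ∈ Ioo p₀ 0) :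
    d1 (d2 W.height) (q, p) = d2 (d1 W.height) (q, p) :=
  d1_d2_comm (hA.contDiffOn_iterate 0) (isOpen_strip p₀ 0) hp

/-- The second derivative in the horizontal variable is bounded. -/
lemma exists_taylor_bound (hA : W.HeightAnalytic α p₀) :
    ∃ M : ℝ, ∀ q s, ∀ p ∈ Ioo p₀ 0,
      |W.height (q + s, p) - W.height (q, p) - s * d1 W.height (q, p)| ≤ M * s ^ 2 := by
  obtain ⟨C, L, hC, hL, hb⟩ := hA.exists_abs_le
  set M := C * L ^ 2 * (Nat.factorial 2 : ℕ) with hM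
  have hM0 : 0 ≤ M := by positivity
  refine ⟨M, fun q s p hp => ?_⟩
  have h1 : ∀ x ∈ uIcc q (q + s), |d1 W.height (x, p) - d1 W.height (q, p)| ≤ M * |s| :=
    fun x hx => by
      have := (convex_univ (𝕜 := ℝ) (E := ℝ)).norm_image_sub_le_of_norm_hasDerivWithin_le
        (f := fun x => d1 W.height (x, p)) (f' := fun x => d1 (d1 W.height) (x, p)) (C := M)
        (fun t _ => (hasDerivAt_fst (hA.differentiableAt_d1 hp)).hasDerivWithinAt)
        (fun t _ => hb 2 (t, p) hp) (mem_univ q) (mem_univ x)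
      refine this.trans (mul_le_mul_of_nonneg_left ?_ hM0)
      have := abs_sub_left_of_mem_uIcc hx
      simpa using this
  have h2 := (convex_uIcc q (q + s)).norm_image_sub_le_of_norm_hasDerivWithin_le
    (f := fun x => W.height (x, p) - x * d1 W.height (q, p))
    (f' := fun x => d1 W.height (x, p) - 1 * d1 W.height (q, p)) (C := M * |s|)
    (fun t _ => ((hasDerivAt_fst (hA.differentiableAt hp)).sub
      ((hasDerivAt_id t).mul_const _)).hasDerivWithinAt)
    (fun t ht => by simpa using h1 t ht) left_mem_uIcc right_mem_uIcc
  simp only [Real.norm_eq_abs, add_sub_cancel_left] at h2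
  calc |W.height (q + s, p) - W.height (q, p) - s * d1 W.height (q, p)| = _ := by
        congr 1; ring
    _ ≤ _ := h2
    _ = M * s ^ 2 := by rw [mul_assoc, ← abs_mul, ← sq, abs_of_nonneg (sq_nonneg s)]

end HeightAnalytic

namespace IsSymmetricWave

/-- Differentiate ψ(q, h(q,p)) = -p in p; only ψ_y = u enters. -/
lemma u_mul_d2_height (hW : W.IsSymmetricWave g σ α) (h0 : (0, y₀) ∈ W.closedDomain)
    (hA : W.HeightAnalytic α (-W.stream (0, y₀))) (q : ℝ) {p : ℝ}
    (hp : p ∈ Ioo (-W.stream (0, y₀)) 0) :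
    W.u (q, W.height (q, p)) * d2 W.height (q, p) = -1 := by
  have h1 := (hW.hasDerivAt_stream (hW.height_mem_domain h0 q hp)).comp p
    (hasDerivAt_snd (hA.differentiableAt hp))
  refine h1.unique ((hasDerivAt_neg p).congr_of_eventuallyEq ?_)
  filter_upwards [Ioo_mem_nhds hp.1 hp.2] with t ht
  exact hW.stream_height h0 q (Ioo_subset_Icc_self ht)

section Composition

variable {f : ℝ × ℝ → ℝ}

lemma hasDerivAt_comp_height_fst (hW : W.IsSymmetricWave g σ α) (h0 : (0, y₀) ∈ W.closedDomain)
    (hA : W.HeightAnalytic α (-W.stream (0, y₀))) (hf : ∀ z ∈ W.domain, DifferentiableAt ℝ f z)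
    (q : ℝ) {p : ℝ} (hp : p ∈ Ioo (-W.stream (0, y₀)) 0) :
    HasDerivAt (fun t => f (t, W.height (t, p)))
      (d1 f (q, W.height (q, p)) + d2 f (q, W.height (q, p)) * d1 W.height (q, p)) q := by
  simpa using hasDerivAt_comp_prod (a := fun t => t) (b := fun t => W.height (t, p))
    (hf _ (hW.height_mem_domain h0 q hp)) (hasDerivAt_id q)
    (hasDerivAt_fst (hA.differentiableAt hp))

lemma hasDerivAt_comp_height_snd (hW : W.IsSymmetricWave g σ α) (h0 : (0, y₀) ∈ W.closedDomain)
    (hA : W.HeightAnalytic α (-W.stream (0, y₀))) (hf : ∀ z ∈ W.domain, DifferentiableAt ℝ f z)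
    (q : ℝ) {p : ℝ} (hp : p ∈ Ioo (-W.stream (0, y₀)) 0) :
    HasDerivAt (fun t => f (q, W.height (q, t)))
      (d2 f (q, W.height (q, p)) * d2 W.height (q, p)) p := by
  simpa using hasDerivAt_comp_prod (a := fun _ => q) (b := fun t => W.height (q, t))
    (hf _ (hW.height_mem_domain h0 q hp)) (hasDerivAt_const p q)
    (hasDerivAt_snd (hA.differentiableAt hp))

end Composition

lemma d1_u_mul_d2_height (hW : W.IsSymmetricWave g σ α) (h0 : (0, y₀) ∈ W.closedDomain)
    (hA : W.HeightAnalytic α (-W.stream (0, y₀))) (q : ℝ) {p : ℝ}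
    (hp : p ∈ Ioo (-W.stream (0, y₀)) 0) :
    (d1 W.u (q, W.height (q, p)) + d2 W.u (q, W.height (q, p)) * d1 W.height (q, p))
      * d2 W.height (q, p) + W.u (q, W.height (q, p)) * d2 (d1 W.height) (q, p) = 0 := by
  have h1 := (hW.hasDerivAt_comp_height_fst h0 hA (fun _ => hW.differentiableAt_u) q hp).mul
    (hasDerivAt_fst (hA.differentiableAt_d2 hp))
  rw [hA.d1_d2_height hp] at h1
  exact h1.unique ((hasDerivAt_const q (-1 : ℝ)).congr_of_eventuallyEq
    (Eventually.of_forall fun t => hW.u_mul_d2_height h0 hA t hp))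

lemma d2_u_mul_d2_height (hW : W.IsSymmetricWave g σ α) (h0 : (0, y₀) ∈ W.closedDomain)
    (hA : W.HeightAnalytic α (-W.stream (0, y₀))) (q : ℝ) {p : ℝ}
    (hp : p ∈ Ioo (-W.stream (0, y₀)) 0) :
    d2 W.u (q, W.height (q, p)) * d2 W.height (q, p) * d2 W.height (q, p)
      + W.u (q, W.height (q, p)) * d2 (d2 W.height) (q, p) = 0 := by
  have h1 := (hW.hasDerivAt_comp_height_snd h0 hA (fun _ => hW.differentiableAt_u) q hp).mul
    (hasDerivAt_snd (hA.differentiableAt_d2 (q := q) hp))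
  refine h1.unique ((hasDerivAt_const p (-1 : ℝ)).congr_of_eventuallyEq ?_)
  filter_upwards [Ioo_mem_nhds hp.1 hp.2] with t ht using hW.u_mul_d2_height h0 hA q ht

lemma height_surface_le (hW : W.IsSymmetricWave g σ α) (h0 : (0, y₀) ∈ W.closedDomain) {δ : ℝ}
    (hδ : 0 < δ) (hu : ∀ z ∈ W.closedDomain, W.u z ≤ -δ) (q : ℝ) {p : ℝ}
    (hp : p ∈ Icc (-W.stream (0, y₀)) 0) : |W.height (q, p) - W.η q| ≤ -p / δ := by
  have := hW.mul_abs_sub_le hu (hW.height_mem_closedDomain h0 q hp) (hW.surface_mem q)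
  rw [hW.stream_height h0 q hp, stream_surface, sub_zero,
    abs_of_nonneg (neg_nonneg.2 hp.2)] at this
  rw [le_div_iff₀ hδ]
  linarith

lemma stream_pos (hW : W.IsSymmetricWave g σ α) (h0 : (0, y₀) ∈ W.closedDomain)
    (hlt : y₀ < W.η 0) : 0 < W.stream (0, y₀) := by
  have := hW.stream_lt h0 hlt le_rfl
  rwa [stream_surface] at this

lemma eventually_mem_layer (hW : W.IsSymmetricWave g σ α) (h0 : (0, y₀) ∈ W.closedDomain)
    (hlt : y₀ < W.η 0) : ∀ᶠ p in 𝓝[<] (0 : ℝ), p ∈ Ioo (-W.stream (0, y₀)) 0 :=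
  Ioo_mem_nhdsLT (neg_lt_zero.2 (hW.stream_pos h0 hlt))

lemma tendsto_height (hW : W.IsSymmetricWave g σ α) (h0 : (0, y₀) ∈ W.closedDomain)
    (hlt : y₀ < W.η 0) (q : ℝ) :
    Tendsto (fun p => W.height (q, p)) (𝓝[<] 0) (𝓝 (W.η q)) := by
  obtain ⟨δ, hδ, hu⟩ := hW.exists_u_le
  rw [tendsto_iff_norm_sub_tendsto_zero]
  have hlim : Tendsto (fun p : ℝ => -p / δ) (𝓝[<] 0) (𝓝 0) := by
    have : Continuous fun p : ℝ => -p / δ := by fun_prop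
    simpa using (this.tendsto 0).mono_left nhdsWithin_le_nhds
  refine squeeze_zero' (Eventually.of_forall fun _ => norm_nonneg _) ?_ hlim
  filter_upwards [hW.eventually_mem_layer h0 hlt] with p hp
  exact hW.height_surface_le h0 hδ hu q (Ioo_subset_Icc_self hp)

lemma tendsto_comp_height (hW : W.IsSymmetricWave g σ α) (h0 : (0, y₀) ∈ W.closedDomain)
    (hlt : y₀ < W.η 0) {f : ℝ × ℝ → ℝ} (hf : ContinuousOn f W.closedDomain) (q : ℝ) :
    Tendsto (fun p => f (q, W.height (q, p))) (𝓝[<] 0) (𝓝 (f (q, W.η q))) := by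
  refine (hf _ (hW.surface_mem q)).tendsto.comp (tendsto_nhdsWithin_iff.2
    ⟨tendsto_const_nhds.prodMk_nhds (hW.tendsto_height h0 hlt q), ?_⟩)
  filter_upwards [hW.eventually_mem_layer h0 hlt] with p hp
  exact hW.height_mem_closedDomain h0 q (Ioo_subset_Icc_self hp)

/-- The curves `p = const` are streamlines. -/
lemma v_eq (hW : W.IsSymmetricWave g σ α) (h0 : (0, y₀) ∈ W.closedDomain) (hlt : y₀ < W.η 0)
    (hA : W.HeightAnalytic α (-W.stream (0, y₀))) (q : ℝ) {p : ℝ}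
    (hp : p ∈ Ioo (-W.stream (0, y₀)) 0) :
    W.v (q, W.height (q, p)) = W.u (q, W.height (q, p)) * d1 W.height (q, p) := by
  -- The defect K = v - u h_q has K_p = h_p (u_x + v_y) = 0, by the q-derivative of u h_p = -1. Its
  -- constant value is found at the surface.
  set K : ℝ → ℝ := fun p =>
    W.v (q, W.height (q, p)) - W.u (q, W.height (q, p)) * d1 W.height (q, p) with hK
  have hK' : ∀ t ∈ Ioo (-W.stream (0, y₀)) 0, HasDerivAt K 0 t := fun t ht => by
    have h1 := (hW.hasDerivAt_comp_height_snd h0 hA (fun _ => hW.differentiableAt_v) q ht).sub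
      ((hW.hasDerivAt_comp_height_snd h0 hA (fun _ => hW.differentiableAt_u) q ht).mul
        (hasDerivAt_snd (hA.differentiableAt_d1 (q := q) ht)))
    refine h1.congr_deriv ?_
    linear_combination d2 W.height (q, t) * hW.incompressible _ (hW.height_mem_domain h0 q ht)
      - hW.d1_u_mul_d2_height h0 hA q ht
  have hconst : ∀ t ∈ Ioo (-W.stream (0, y₀)) 0, K t = K p := fun t ht =>
    isOpen_Ioo.is_const_of_deriv_eq_zero isPreconnected_Ioo
      (fun s hs => (hK' s hs).differentiableAt.differentiableWithinAt)
      (fun s hs => (hK' s hs).deriv) ht hp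
  obtain ⟨δ, hδ, hu⟩ := hW.exists_u_le
  have hu0 : ∀ z ∈ W.closedDomain, W.u z ≠ 0 := fun z hz => by linarith [hu z hz] |> ne_of_lt
  -- Since K is constant, h_q = (v - K)/u converges at the surface.
  have hlim : Tendsto (fun t => d1 W.height (q, t)) (𝓝[<] 0)
      (𝓝 ((W.v (q, W.η q) - K p) / W.u (q, W.η q))) := by
    refine (((hW.tendsto_comp_height h0 hlt hW.v_cont q).sub_const (K p)).div
      (hW.tendsto_comp_height h0 hlt hW.u_cont q) (hu0 _ (hW.surface_mem q))).congr' ?_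
    filter_upwards [hW.eventually_mem_layer h0 hlt] with t ht
    have := hu0 _ (hW.height_mem_closedDomain h0 q (Ioo_subset_Icc_self ht))
    simp only [Pi.div_apply]
    rw [← hconst t ht, div_eq_iff this]
    simp only [hK]
    ring
  set ℓ := (W.v (q, W.η q) - K p) / W.u (q, W.η q) with hℓ
  obtain ⟨M, hM⟩ := hA.exists_taylor_bound
  -- The Taylor bound is uniform in p and survives the limit p → 0, so the limit of h_q is η'(q);
  -- the kinematic condition then forces K = 0.
  have hTaylor : ∀ s, |W.η (q + s) - W.η q - s * ℓ| ≤ M * s ^ 2 := fun s => by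
    refine le_of_tendsto (((hW.tendsto_height h0 hlt (q + s)).sub
      (hW.tendsto_height h0 hlt q)).sub (hlim.const_mul s)).abs ?_
    filter_upwards [hW.eventually_mem_layer h0 hlt] with t ht using hM q s t ht
  have hder : HasDerivAt W.η ℓ q := by
    rw [hasDerivAt_iff_isLittleO_nhds_zero]
    refine Asymptotics.IsBigO.trans_isLittleO (g := fun s : ℝ => s ^ 2) ?_
      (by simpa using Asymptotics.isLittleO_pow_pow (𝕜 := ℝ) one_lt_two)
    refine Asymptotics.IsBigO.of_bound M (Eventually.of_forall fun s => ?_)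
    simpa using hTaylor s
  have hKp : K p = 0 := by
    have h1 := hW.kinematic q
    rw [hder.deriv, hℓ, mul_div_cancel₀ _ (hu0 _ (hW.surface_mem q))] at h1
    linarith
  exact sub_eq_zero.1 hKp

/-- Oddness gives v = 0 on the axis, and v = u h_q with u ≠ 0. -/
lemma d1_height_zero (hW : W.IsSymmetricWave g σ α) (h0 : (0, y₀) ∈ W.closedDomain)
    (hlt : y₀ < W.η 0) (hA : W.HeightAnalytic α (-W.stream (0, y₀))) {p : ℝ}
    (hp : p ∈ Ioo (-W.stream (0, y₀)) 0) : d1 W.height (0, p) = 0 := by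
  have h1 := hW.v_odd 0 _ (hW.height_mem_domain h0 0 hp)
  rw [neg_zero] at h1
  have h2 := hW.v_eq h0 hlt hA 0 hp
  have h3 := hW.u_mul_d2_height h0 hA 0 hp
  have h4 : W.v (0, W.height (0, p)) = 0 := by linarith
  rw [h4] at h2
  refine (mul_eq_zero.1 h2.symm).resolve_left fun h => ?_
  rw [h, zero_mul] at h3
  norm_num at h3

/-- The vorticity is constant along streamlines, by Bernoulli's law. -/
lemma vorticity_height (hW : W.IsSymmetricWave g σ α) (h0 : (0, y₀) ∈ W.closedDomain)
    (hlt : y₀ < W.η 0) (hA : W.HeightAnalytic α (-W.stream (0, y₀))) (q : ℝ) {p : ℝ}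
    (hp : p ∈ Ioo (-W.stream (0, y₀)) 0) :
    W.vorticity (q, W.height (q, p)) = W.vorticityFn p := by
  -- E is the Bernoulli head: E_q = 0 along streamlines, and E_p = u h_p ω = -ω. As E does not
  -- depend on q, neither does ω.
  set E : ℝ → ℝ → ℝ := fun q p => W.P (q, W.height (q, p))
    + (W.u (q, W.height (q, p)) ^ 2 + W.v (q, W.height (q, p)) ^ 2) / 2
    + g * W.height (q, p) with hE
  have hEq : ∀ t ∈ Ioo (-W.stream (0, y₀)) 0, ∀ x, HasDerivAt (fun x => E x t) 0 x :=
    fun t ht x => by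
    have hm := hW.height_mem_domain h0 x ht
    have h1 := ((hW.hasDerivAt_comp_height_fst h0 hA (fun _ => hW.differentiableAt_P) x ht).add
      ((((hW.hasDerivAt_comp_height_fst h0 hA (fun _ => hW.differentiableAt_u) x ht).pow 2).add
        ((hW.hasDerivAt_comp_height_fst h0 hA (fun _ => hW.differentiableAt_v) x ht).pow
          2)).div_const 2)).add ((hasDerivAt_fst (hA.differentiableAt (q := x) ht)).const_mul g)
    refine h1.congr_deriv ?_
    have e1 := hW.euler_x _ hm
    have e2 := hW.euler_y _ hm
    have e3 := hW.v_eq h0 hlt hA x ht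
    push_cast
    linear_combination e1 + d1 W.height (x, t) * e2
      + (d1 W.v (x, W.height (x, t)) - d2 W.u (x, W.height (x, t))) * e3
  have hEp : ∀ x, HasDerivAt (fun t => E x t) (-W.vorticity (x, W.height (x, p))) p := fun x => by
    have hm := hW.height_mem_domain h0 x hp
    have h1 := ((hW.hasDerivAt_comp_height_snd h0 hA (fun _ => hW.differentiableAt_P) x hp).add
      ((((hW.hasDerivAt_comp_height_snd h0 hA (fun _ => hW.differentiableAt_u) x hp).pow 2).add
        ((hW.hasDerivAt_comp_height_snd h0 hA (fun _ => hW.differentiableAt_v) x hp).pow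
          2)).div_const 2)).add ((hasDerivAt_snd (hA.differentiableAt (q := x) hp)).const_mul g)
    refine h1.congr_deriv ?_
    have e2 := hW.euler_y _ hm
    have e3 := hW.u_mul_d2_height h0 hA x hp
    simp only [vorticity]
    push_cast
    linear_combination d2 W.height (x, p) * e2
      + (d2 W.u (x, W.height (x, p)) - d1 W.v (x, W.height (x, p))) * e3
  have hconst : ∀ t ∈ Ioo (-W.stream (0, y₀)) 0, E q t = E 0 t := fun t ht =>
    is_const_of_deriv_eq_zero (fun x => (hEq t ht x).differentiableAt)
      (fun x => (hEq t ht x).deriv) q 0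
  have := (hEp q).unique ((hEp 0).congr_of_eventuallyEq
    (by filter_upwards [Ioo_mem_nhds hp.1 hp.2] with t ht using hconst t ht))
  rw [vorticityFn, hW.hodographInv_eq h0 0 (Ioo_subset_Icc_self hp)]
  linarith

theorem analyticHeight (hW : W.IsSymmetricWave g σ α) (h0 : (0, y₀) ∈ W.closedDomain)
    (hlt : y₀ < W.η 0) (hA : W.HeightAnalytic α (-W.stream (0, y₀))) :
    AnalyticHeight (-W.stream (0, y₀)) 0 W.vorticityFn W.height where
  contDiffOn := hA.contDiffOn_iterate
  bound := hA.exists_abs_le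
  d2_ne_zero := fun ⟨q, p⟩ hp h => by
    have := hW.u_mul_d2_height h0 hA q hp
    rw [h, mul_zero] at this
    norm_num at this
  equation := by
    rintro ⟨q, p⟩ hp
    change p ∈ Ioo _ _ at hp
    have hw := hW.vorticity_height h0 hlt hA q hp
    have e1 := hW.u_mul_d2_height h0 hA q hp
    have e2 := hW.d1_u_mul_d2_height h0 hA q hp
    have e3 := hW.d2_u_mul_d2_height h0 hA q hp
    have e4 := hW.incompressible _ (hW.height_mem_domain h0 q hp)
    -- the streamline relation, differentiated along the streamline
    have e5 := (hW.hasDerivAt_comp_height_fst h0 hA (fun _ => hW.differentiableAt_v) q hp).unique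
      (((hW.hasDerivAt_comp_height_fst h0 hA (fun _ => hW.differentiableAt_u) q hp).mul
        (hasDerivAt_fst (hA.differentiableAt_d1 hp))).congr_of_eventuallyEq
          (Eventually.of_forall fun x => hW.v_eq h0 hlt hA x hp))
    simp only [vorticity] at hw
    simp only at e5 ⊢
    rw [← hw]
    generalize d1 W.u (q, W.height (q, p)) = ux at *
    generalize d2 W.u (q, W.height (q, p)) = uy at *
    generalize d1 W.v (q, W.height (q, p)) = vx at *
    generalize d2 W.v (q, W.height (q, p)) = vy at *
    generalize W.u (q, W.height (q, p)) = u at *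
    generalize d1 (d1 W.height) (q, p) = x at *
    generalize d2 (d1 W.height) (q, p) = c at *
    generalize d2 (d2 W.height) (q, p) = e at *
    generalize d1 W.height (q, p) = a at *
    generalize d2 W.height (q, p) = b at *
    -- By `e1`, multiplying the left-hand side of the height equation by -u h_p does not change it;
    -- `e3`, `e2`, `e5` express u h_pp, u h_pq, u h_qq through the velocity gradient, and with
    -- incompressibility only h_p³ (u_y - v_x) remains.
    linear_combination
      ((1 + a ^ 2) * e - 2 * a * b * c + b ^ 2 * x - (uy - vx) * b ^ 3 + b ^ 3 * (uy - vx)) * e1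
        - b * ((1 + a ^ 2) * e3 - 2 * a * b * e2 - b ^ 2 * e5 + b ^ 2 * a * e4)

end IsSymmetricWave

end WaterWave.Flow

/-! ### Recovering the layer and the velocity from the height function. -/

namespace WaterWave.Flow

open Set Filter Topology

namespace IsSymmetricWave

variable {W : Flow} {g σ α y₀ : ℝ}

lemma le_height (hW : W.IsSymmetricWave g σ α) (h0 : (0, y₀) ∈ W.closedDomain) {q c p : ℝ}
    (hc : (q, c) ∈ W.closedDomain) (hcs : W.stream (0, y₀) ≤ W.stream (q, c))
    (hp : p ∈ Icc (-W.stream (0, y₀)) 0) : c ≤ W.height (q, p) := by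
  by_contra! hlt
  have h1 := hW.stream_lt (hW.height_mem_closedDomain h0 q hp) hlt hc.2
  rw [hW.stream_height h0 q hp] at h1
  linarith [hp.1]

/-- This describes the layer, boundary streamlines included, by values of h in the open strip alone,
where uniqueness is known. -/
lemma mem_layer_iff (hW : W.IsSymmetricWave g σ α) (h0 : (0, y₀) ∈ W.closedDomain)
    (hlt : y₀ < W.η 0) (x y : ℝ) :
    (x, y) ∈ W.layer (-W.stream (0, y₀)) ↔
      y ∈ closure ((fun p => W.height (x, p)) '' Ioo (-W.stream (0, y₀)) 0) := by
  constructor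
  · rintro ⟨hm, h1, h2⟩
    obtain ⟨δ, hδ, hu⟩ := hW.exists_u_le
    refine Metric.mem_closure_iff.2 fun ε hε => ?_
    have hcl : -W.stream (x, y) ∈ closure (Ioo (-W.stream (0, y₀)) 0) := by
      rw [closure_Ioo (neg_lt_zero.2 (hW.stream_pos h0 hlt)).ne]
      exact ⟨by linarith, by linarith⟩
    -- Stream values within δε give heights within ε, since ψ has slope at least δ in absolute
    -- value.
    obtain ⟨p, hp, hpd⟩ := Metric.mem_closure_iff.1 hcl (δ * ε) (mul_pos hδ hε)
    refine ⟨_, mem_image_of_mem _ hp, ?_⟩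
    have hp' := Ioo_subset_Icc_self hp
    have h3 := hW.mul_abs_sub_le hu hm (hW.height_mem_closedDomain h0 x hp')
    rw [hW.stream_height h0 x hp'] at h3
    rw [Real.dist_eq] at hpd ⊢
    have h4 : |W.stream (x, y) - -p| = |-W.stream (x, y) - p| := by
      rw [← abs_neg]
      congr 1
      ring
    exact lt_of_mul_lt_mul_left (h3.trans_lt (h4 ▸ hpd)) hδ.le
  · intro hy
    obtain ⟨c, hc, hcs⟩ := hW.exists_le_stream h0 x
    have hclosed : IsClosed (Icc c (W.η x) ∩
        (fun s => W.stream (x, s)) ⁻¹' Icc 0 (W.stream (0, y₀))) :=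
      (hW.continuousOn_stream_line hc).preimage_isClosed_of_isClosed isClosed_Icc isClosed_Icc
    have hsub := closure_minimal (t := Icc c (W.η x) ∩
        (fun s => W.stream (x, s)) ⁻¹' Icc 0 (W.stream (0, y₀))) (by
      rintro _ ⟨p, hp, rfl⟩
      have hp' := Ioo_subset_Icc_self hp
      refine ⟨⟨hW.le_height h0 hc hcs hp', (hW.height_mem_closedDomain h0 x hp').2⟩, ?_⟩
      simp only [mem_preimage, hW.stream_height h0 x hp']
      exact ⟨by linarith [hp.2], by linarith [hp.1]⟩) hclosed hy
    exact ⟨mem_closedDomain_of_le hc hsub.1.1 hsub.1.2, hsub.2.1, by simpa using hsub.2.2⟩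

end IsSymmetricWave

variable {W₁ W₂ : Flow} {g₁ σ₁ g₂ σ₂ α y₀ : ℝ}

/-- Fields that are continuous up to the boundary agree in the layer if they agree on the
streamlines inside it. -/
lemma eqOn_layer (hW₁ : W₁.IsSymmetricWave g₁ σ₁ α) (h₁ : (0, y₀) ∈ W₁.closedDomain)
    (hlt₁ : y₀ < W₁.η 0)
    (hlayer : W₁.layer (-W₁.stream (0, y₀)) = W₂.layer (-W₂.stream (0, y₀)))
    {f₁ f₂ : ℝ × ℝ → ℝ} (hf₁ : ContinuousOn f₁ W₁.closedDomain)
    (hf₂ : ContinuousOn f₂ W₂.closedDomain)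
    (h : ∀ q, ∀ p ∈ Ioo (-W₁.stream (0, y₀)) 0,
      f₁ (q, W₁.height (q, p)) = f₂ (q, W₁.height (q, p))) :
    EqOn f₁ f₂ (W₁.layer (-W₁.stream (0, y₀))) := by
  rintro ⟨x, y⟩ hz
  set A := (fun p => W₁.height (x, p)) '' Ioo (-W₁.stream (0, y₀)) 0
  have hA : ∀ s ∈ closure A, (x, s) ∈ W₁.layer (-W₁.stream (0, y₀)) :=
    fun s hs => (hW₁.mem_layer_iff h₁ hlt₁ x s).2 hs
  have hEq : EqOn (fun s => f₁ (x, s)) (fun s => f₂ (x, s)) A := by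
    rintro _ ⟨p, hp, rfl⟩
    exact h x p hp
  exact hEq.of_subset_closure (hf₁.comp (by fun_prop) fun s hs => (hA s hs).1)
    (hf₂.comp (by fun_prop) fun s hs => (hlayer ▸ hA s hs).1) subset_closure le_rfl
    ((hW₁.mem_layer_iff h₁ hlt₁ x y).1 hz)

end WaterWave.Flow

/-! ### The uniqueness theorem. -/

open WaterWave in
theorem theorem2p1 (α : ℝ) (hα0 : 0 < α) (hα1 : α < 1)
    (g₁ σ₁ g₂ σ₂ : ℝ) (hg₁ : 0 ≤ g₁) (hσ₁ : 0 ≤ σ₁) (hgσ₁ : 0 < g₁ + σ₁)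
    (hg₂ : 0 ≤ g₂) (hσ₂ : 0 ≤ σ₂) (hgσ₂ : 0 < g₂ + σ₂)
    (W₁ W₂ : Flow) (hW₁ : W₁.IsSymmetricWave g₁ σ₁ α) (hW₂ : W₂.IsSymmetricWave g₂ σ₂ α)
    -- the point `(0, ybar)` of the closed fluid domains lies below the surface
    (ybar : ℝ) (hy₁ : (0, ybar) ∈ W₁.closedDomain) (hlt₁ : ybar < W₁.η 0)
    (hy₂ : (0, ybar) ∈ W₂.closedDomain) (hlt₂ : ybar < W₂.η 0)
    -- the analytic bounds in the strips, with `pbar = -ψ(0, ybar)`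
    (hh₁ : W₁.HeightAnalytic α (-W₁.stream (0, ybar)))
    (hh₂ : W₂.HeightAnalytic α (-W₂.stream (0, ybar)))
    -- the functions `y ↦ u(0,y)` on `[ybar, η(0)]` coincide
    (hη : W₁.η 0 = W₂.η 0)
    (hu : ∀ y ∈ Set.Icc ybar (W₁.η 0), W₁.u (0, y) = W₂.u (0, y))
    -- the vorticity functions coincide in the layer
    (hγ : ∀ p ∈ Set.Ioo (-W₁.stream (0, ybar)) 0, W₁.vorticityFn p = W₂.vorticityFn p) :
    W₁.η = W₂.η ∧
      W₁.layer (-W₁.stream (0, ybar)) = W₂.layer (-W₂.stream (0, ybar)) ∧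
      Set.EqOn W₁.u W₂.u (W₁.layer (-W₁.stream (0, ybar))) ∧
      Set.EqOn W₁.v W₂.v (W₁.layer (-W₁.stream (0, ybar))) := by
  have hstream : ∀ y ∈ Set.Icc ybar (W₁.η 0), W₁.stream (0, y) = W₂.stream (0, y) := fun y hy => by
    simp only [Flow.stream, ← hη]
    congr 1
    refine intervalIntegral.integral_congr fun s hs => ?_
    rw [Set.uIcc_of_le hy.2] at hs
    exact hu s ⟨hy.1.trans hs.1, hs.2⟩
  have hp0 : W₁.stream (0, ybar) = W₂.stream (0, ybar) := hstream _ ⟨le_rfl, hlt₁.le⟩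
  have A₁ := hW₁.analyticHeight hy₁ hlt₁ hh₁
  have A₂ : AnalyticHeight (-W₁.stream (0, ybar)) 0 W₁.vorticityFn W₂.height :=
    { hp0 ▸ hW₂.analyticHeight hy₂ hlt₂ hh₂ with
      equation := fun z hz => by
        rw [hγ z.2 hz]
        exact (hp0 ▸ hW₂.analyticHeight hy₂ hlt₂ hh₂ :
          AnalyticHeight (-W₁.stream (0, ybar)) 0 W₂.vorticityFn W₂.height).equation z hz }
  have hmem : ∀ {p}, p ∈ Set.Ioo (-W₁.stream (0, ybar)) 0 →
      p ∈ Set.Ioo (-W₂.stream (0, ybar)) 0 := fun hp => hp0 ▸ hp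
  -- Cauchy data on q = 0: equal stream functions on the axis give equal heights, and both h_q
  -- vanish there.
  have H : Set.EqOn W₁.height W₂.height {z | -W₁.stream (0, ybar) < z.2 ∧ z.2 < 0} := by
    refine A₁.eqOn A₂ (fun p hp => ?_) fun p hp => ?_
    · have hp' := Set.Ioo_subset_Icc_self hp
      have hy : W₁.height (0, p) ∈ Set.Icc ybar (W₁.η 0) :=
        ⟨hW₁.le_height hy₁ hy₁ le_rfl hp', (hW₁.height_mem_closedDomain hy₁ 0 hp').2⟩
      refine (hW₂.height_eq (Flow.IsSymmetricWave.mem_closedDomain_of_le hy₂ hy.1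
        (hη ▸ hy.2)) ?_).symm
      rw [← hstream _ hy, hW₁.stream_height hy₁ 0 hp']
    · rw [hW₁.d1_height_zero hy₁ hlt₁ hh₁ hp, hW₂.d1_height_zero hy₂ hlt₂ hh₂ (hmem hp)]
  have hηeq : W₁.η = W₂.η := funext fun x => by
    refine tendsto_nhds_unique (hW₁.tendsto_height hy₁ hlt₁ x)
      ((hW₂.tendsto_height hy₂ hlt₂ x).congr' ?_)
    filter_upwards [hW₁.eventually_mem_layer hy₁ hlt₁] with p hp using (H (x := (x, p)) hp).symm
  have hlayer : W₁.layer (-W₁.stream (0, ybar)) = W₂.layer (-W₂.stream (0, ybar)) := by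
    ext ⟨x, y⟩
    rw [hW₁.mem_layer_iff hy₁ hlt₁, hW₂.mem_layer_iff hy₂ hlt₂, ← hp0]
    have : (fun p => W₁.height (x, p)) '' Set.Ioo (-W₁.stream (0, ybar)) 0 =
        (fun p => W₂.height (x, p)) '' Set.Ioo (-W₁.stream (0, ybar)) 0 :=
      Set.image_congr fun p hp => H (x := (x, p)) hp
    rw [this]
  -- Both velocities equal -1/h_p with the same h.
  have hueq : ∀ q, ∀ p ∈ Set.Ioo (-W₁.stream (0, ybar)) 0,
      W₁.u (q, W₁.height (q, p)) = W₂.u (q, W₁.height (q, p)) := fun q p hp => by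
    have e1 := hW₁.u_mul_d2_height hy₁ hh₁ q hp
    have e2 := hW₂.u_mul_d2_height hy₂ hh₂ q (hmem hp)
    rw [← H (x := (q, p)) hp, ← eqOn_d2 H (isOpen_strip _ _) (x := (q, p)) hp] at e2
    exact mul_right_cancel₀ (A₁.d2_ne_zero (q, p) hp) (e1.trans e2.symm)
  refine ⟨hηeq, hlayer, Flow.eqOn_layer hW₁ hy₁ hlt₁ hlayer hW₁.u_cont hW₂.u_cont hueq,
    Flow.eqOn_layer hW₁ hy₁ hlt₁ hlayer hW₁.v_cont hW₂.v_cont fun q p hp => ?_⟩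
  have e2 := hW₂.v_eq hy₂ hlt₂ hh₂ q (hmem hp)
  rw [← H (x := (q, p)) hp, ← eqOn_d1 H (isOpen_strip _ _) (x := (q, p)) hp,
    ← hueq q p hp] at e2
  rw [hW₁.v_eq hy₁ hlt₁ hh₁ q hp, e2]
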